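/- Let $k=2$ or $k=3$, let $m\ge 0$ be an integer, let $[\cdot,\cdot]:\mathbf R^m\times\mathbf R^m\to\mathbf R^k$ be a nonzero bilinear map, and let $\varphi:[0,\infty)\times[0,\infty)\to[0,\infty)$ be a $C^\infty$ function with compact support that is not identically zero. For $Z\in\mathbf R^k$, the Lie algebra of the torus $SO(2)\times\dots\times SO(2)$ acting on $\mathbf R^{2k}=\mathbf R^2\times\dots\times\mathbf R^2$ by rotations in each factor, let $Z^*_u=\frac{d}{dt}\big|_{t=0}\exp(tZ)\cdot u$ for $u\in\mathbf R^{2k}$. Given a smooth compactly supported function $\chi:[0,\infty)^2\to[0,\infty)$, let $g^{[\cdot,\cdot],\chi}$ be the Riemannian metric on $\mathbf R^{m+2k}=\mathbf R^m\times\mathbf R^{2k}$ for which, at each point $(x,u)$, the subspace $\{0\}\oplus\mathbf R^{2k}$ carries its Euclidean inner product, its orthogonal complement is the set of all vectors $\tilde Y=\big(Y,\ \chi(\|x\|^2,\|u\|^2)\,[x,Y]^*_u\big)$ with $Y\in\mathbf R^m$, and the map $Y\mapsto\tilde Y$ is an isometry onto that complement, where $\mathbf R^m$ has the Euclidean inner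 product. For $s>0$ put $\varphi_s(t_1,t_2)=\varphi(t_1,s^2t_2)$ and $g^s=g^{[\cdot,\cdot],\varphi_s}$. For a Riemannian metric $g$ on $\mathbf R^n$ with curvature tensor $R$, Ricci tensor $\mathrm{Ric}$ and scalar curvature $\tau$, let the second heat invariant be $$a_2(g)=\frac{(4\pi)^{-n/2}}{360}\int_{\mathbf R^n}\big(5\tau^2-2\|\mathrm{Ric}\|^2+2\|R\|^2\big)\,d\mathrm{vol}_g .$$ Then $a_2(g^s)\neq 0$ for all but finitely many $s>0$. -/

import Mathlib

open Set MeasureTheory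
open scoped ContDiff

noncomputable section

namespace HeatInvariant

/-! ### Riemannian geometry of `ℝ^ι` in its global standard chart

A metric on `ℝ^ι` is given by its matrix of components `g z i j = g_z(∂ᵢ, ∂ⱼ)`. -/

section Curvature

variable {ι : Type*} [Fintype ι] [DecidableEq ι]

/-- The partial derivative `∂ᵢ f` at `z`. -/
def partialDeriv (i : ι) (f : EuclideanSpace ℝ ι → ℝ) (z : EuclideanSpace ℝ ι) : ℝ :=
  fderiv ℝ f z (EuclideanSpace.single i 1)

variable (g : EuclideanSpace ℝ ι → Matrix ι ι ℝ)

/-- Christoffel symbols of the Levi-Civita connection: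
`Γˡᵢⱼ = ½ ∑ₐ gˡᵃ (∂ᵢ gⱼₐ + ∂ⱼ gᵢₐ - ∂ₐ gᵢⱼ)`. -/
def christoffel (l i j : ι) (z : EuclideanSpace ℝ ι) : ℝ :=
  (1 / 2 : ℝ) * ∑ a, (g z)⁻¹ l a *
    (partialDeriv i (fun y => g y j a) z + partialDeriv j (fun y => g y i a) z
      - partialDeriv a (fun y => g y i j) z)

/-- The components `Rˡₖᵢⱼ` of the curvature tensor, `R(∂ᵢ, ∂ⱼ)∂ₖ = ∑ₗ Rˡₖᵢⱼ ∂ₗ`, where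
`R(X, Y) = ∇_X ∇_Y - ∇_Y ∇_X - ∇_[X,Y]`. -/
def curvatureUp (l k i j : ι) (z : EuclideanSpace ℝ ι) : ℝ :=
  partialDeriv i (christoffel g l j k) z - partialDeriv j (christoffel g l i k) z
    + ∑ p, (christoffel g l i p z * christoffel g p j k z
      - christoffel g l j p z * christoffel g p i k z)

/-- The components `R_{abcd} = g(R(∂_c, ∂_d)∂_b, ∂_a)`. -/
def curvature (a b c d : ι) (z : EuclideanSpace ℝ ι) : ℝ :=
  ∑ l, g z a l * curvatureUp g l b c d z

/-- The Ricci tensor `Ric_{ab} = ∑_{c,d} g^{cd} R_{acbd}`. -/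
def ricci (a b : ι) (z : EuclideanSpace ℝ ι) : ℝ :=
  ∑ c, ∑ d, (g z)⁻¹ c d * curvature g a c b d z

/-- The scalar curvature `τ`. -/
def scalarCurvature (z : EuclideanSpace ℝ ι) : ℝ :=
  ∑ a, ∑ b, (g z)⁻¹ a b * ricci g a b z

/-- The squared norm `‖Ric‖²` with respect to `g`. -/
def ricciNormSq (z : EuclideanSpace ℝ ι) : ℝ :=
  ∑ a, ∑ b, ∑ a', ∑ b', (g z)⁻¹ a a' * (g z)⁻¹ b b' * ricci g a b z * ricci g a' b' z

/-- The squared norm `‖R‖²` of the full curvature tensor with respect to `g`. -/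
def curvatureNormSq (z : EuclideanSpace ℝ ι) : ℝ :=
  ∑ a, ∑ b, ∑ c, ∑ d, ∑ a', ∑ b', ∑ c', ∑ d',
    (g z)⁻¹ a a' * (g z)⁻¹ b b' * (g z)⁻¹ c c' * (g z)⁻¹ d d' *
      curvature g a b c d z * curvature g a' b' c' d' z

/-- The second heat invariant
`a₂(g) = (4π)^{-n/2} / 360 * ∫ (5 τ² - 2 ‖Ric‖² + 2 ‖R‖²) dvol_g`, where `n` is the dimension
and `dvol_g = √(det g) dz`. -/
def a2 : ℝ :=
  (4 * Real.pi) ^ (-(Fintype.card ι : ℝ) / 2) / 360 *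
    ∫ z, (5 * scalarCurvature g z ^ 2 - 2 * ricciNormSq g z + 2 * curvatureNormSq g z)
      * Real.sqrt (g z).det

end Curvature

/-! ### The metrics on `ℝ^{m+2k}` -/

section Metric

/-- `ℝ^{2k} = ℝ² × ⋯ × ℝ²`; the coordinates of the `p`-th factor are `(p, 0)` and `(p, 1)`. -/
abbrev Planes (k : ℕ) : Type := EuclideanSpace ℝ (Fin k × Fin 2)

/-- `ℝ^{m+2k} = ℝ^m × ℝ^{2k}`, with points `(x, u)`. -/
abbrev Total (m k : ℕ) : Type := EuclideanSpace ℝ (Fin m ⊕ Fin k × Fin 2)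

variable {m k : ℕ}

/-- The component `x ∈ ℝ^m` of `(x, u)`. -/
def xPart (z : Total m k) : EuclideanSpace ℝ (Fin m) := WithLp.toLp 2 fun i => z (Sum.inl i)

/-- The component `u ∈ ℝ^{2k}` of `(x, u)`. -/
def uPart (z : Total m k) : Planes k := WithLp.toLp 2 fun q => z (Sum.inr q)

/-- The point `(x, u)`. -/
def pair (x : EuclideanSpace ℝ (Fin m)) (u : Planes k) : Total m k :=
  WithLp.toLp 2 (Sum.elim (fun i => x i) fun q => u q)

/-- The action of `exp Z` on `ℝ^{2k}`, where `Z ∈ ℝ^k` is in the Lie algebra of the torus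
`SO(2) × ⋯ × SO(2)`: the `p`-th plane is rotated by the angle `Z_p`. -/
def torusExp (Z : EuclideanSpace ℝ (Fin k)) (u : Planes k) : Planes k :=
  WithLp.toLp 2 fun q =>
    ![Real.cos (Z q.1) * u (q.1, 0) - Real.sin (Z q.1) * u (q.1, 1),
      Real.sin (Z q.1) * u (q.1, 0) + Real.cos (Z q.1) * u (q.1, 1)] q.2

/-- The fundamental vector field `Z*_u = d/dt|_{t = 0} exp(tZ) · u` on `ℝ^{2k}`. -/
def fundVec (Z : EuclideanSpace ℝ (Fin k)) (u : Planes k) : Planes k :=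
  deriv (fun t : ℝ => torusExp (t • Z) u) 0

variable (b : EuclideanSpace ℝ (Fin m) →ₗ[ℝ] EuclideanSpace ℝ (Fin m) →ₗ[ℝ]
    EuclideanSpace ℝ (Fin k)) (φ : ℝ × ℝ → ℝ)

/-- `ψ(x, u) [x, Y]*_u`, where `ψ(x, u) = φ(‖x‖², ‖u‖²)` and `[·,·] = b`, at `z = (x, u)`. -/
def shift (z : Total m k) (Y : EuclideanSpace ℝ (Fin m)) : Planes k :=
  φ (‖xPart z‖ ^ 2, ‖uPart z‖ ^ 2) • fundVec (b (xPart z) Y) (uPart z)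

/-- The vector `Ỹ = (Y, ψ(x, u) [x, Y]*_u)` tangent to `ℝ^{m+2k}` at `z = (x, u)`. -/
def horizLift (z : Total m k) (Y : EuclideanSpace ℝ (Fin m)) : Total m k :=
  pair Y (shift b φ z Y)

/-- The Riemannian metric `g^{[·,·],φ}` at `z`, on tangent vectors `v`, `w`. Since
`(Y, W) = Ỹ + (0, W - ψ [x, Y]*_u)`, this is the inner product that is Euclidean on `0 ⊕ ℝ^{2k}`,
makes the vectors `Ỹ` orthogonal to `0 ⊕ ℝ^{2k}`, and makes `Y ↦ Ỹ` isometric;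
see `metric_eq_iff`. -/
def metric (z v w : Total m k) : ℝ :=
  inner ℝ (xPart v) (xPart w) +
    inner ℝ (uPart v - shift b φ z (xPart v)) (uPart w - shift b φ z (xPart w))

/-- The matrix of `g^{[·,·],φ}` in the standard coordinates of `ℝ^{m+2k}`. -/
def metricMatrix (z : Total m k) :
    Matrix (Fin m ⊕ Fin k × Fin 2) (Fin m ⊕ Fin k × Fin 2) ℝ :=
  Matrix.of fun i j => metric b φ z (EuclideanSpace.single i 1) (EuclideanSpace.single j 1)

/-- The rescaled function `φ_s(t₁, t₂) = φ(t₁, s² t₂)`. -/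
def rescale (s : ℝ) (t : ℝ × ℝ) : ℝ := φ (t.1, s ^ 2 * t.2)

theorem fundVec_apply (Z : EuclideanSpace ℝ (Fin k)) (u : Planes k) :
    fundVec Z u = WithLp.toLp 2 fun q => ![-(Z q.1 * u (q.1, 1)), Z q.1 * u (q.1, 0)] q.2 := by
  have h : HasDerivAt (fun t : ℝ => fun q => torusExp (t • Z) u q)
      (fun q => ![-(Z q.1 * u (q.1, 1)), Z q.1 * u (q.1, 0)] q.2) 0 := by
    rw [hasDerivAt_pi]
    rintro ⟨p, j⟩
    have h1 : HasDerivAt (fun t : ℝ => t * Z p) (Z p) 0 := by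
      simpa using (hasDerivAt_id (0 : ℝ)).mul_const (Z p)
    have hc := h1.cos
    have hs := h1.sin
    fin_cases j
    · simpa [torusExp] using (hc.mul_const (u (p, 0))).fun_sub (hs.mul_const (u (p, 1)))
    · simpa [torusExp] using (hs.mul_const (u (p, 0))).fun_add (hc.mul_const (u (p, 1)))
  exact ((EuclideanSpace.equiv (Fin k × Fin 2) ℝ).symm.hasFDerivAt.comp_hasDerivAt 0 h).deriv

/-- The explicit formula for `metric` agrees with its description by vertical and horizontal
vectors. -/
theorem metric_eq_iff (z : Total m k) (B : LinearMap.BilinForm ℝ (Total m k)) (hB : B.IsSymm) :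
    (∀ v w, B v w = metric b φ z v w) ↔
      (∀ W V : Planes k, B (pair 0 W) (pair 0 V) = inner ℝ W V) ∧
      (∀ (Y : EuclideanSpace ℝ (Fin m)) (V : Planes k),
        B (horizLift b φ z Y) (pair 0 V) = 0) ∧
      ∀ Y Y' : EuclideanSpace ℝ (Fin m),
        B (horizLift b φ z Y) (horizLift b φ z Y') = inner ℝ Y Y' := by
  have hx : ∀ (Y : EuclideanSpace ℝ (Fin m)) (W : Planes k), xPart (pair Y W) = Y :=
    fun _ _ => rfl
  have hu : ∀ (Y : EuclideanSpace ℝ (Fin m)) (W : Planes k), uPart (pair Y W) = W :=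
    fun _ _ => rfl
  have h0 : shift b φ z 0 = 0 := by
    ext q
    obtain ⟨p, j⟩ := q
    fin_cases j <;> simp [shift, fundVec_apply]
  constructor
  · intro h
    refine ⟨fun W V => ?_, fun Y V => ?_, fun Y Y' => ?_⟩ <;>
      simp [h, metric, horizLift, hx, hu, h0]
  · rintro ⟨h1, h2, h3⟩ v w
    have dec : ∀ v : Total m k, v = horizLift b φ z (xPart v)
        + pair 0 (uPart v - shift b φ z (xPart v)) := by
      intro v
      ext i
      rcases i with i | q <;> simp [horizLift, pair, xPart, uPart]
    have h2' : ∀ (Y : EuclideanSpace ℝ (Fin m)) (V : Planes k),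
        B (pair 0 V) (horizLift b φ z Y) = 0 := fun Y V => by
      rw [hB.eq, h2]
    conv_lhs => rw [dec v, dec w]
    simp only [map_add, LinearMap.add_apply, h1, h2, h2', h3, metric]
    ring

end Metric

end HeatInvariant

end

/-! Let `N` be the nilpotent matrix `connMatrix` of the connection and set `y = (x, s u)`. The
matrix of `g^s` is `(1 - N)ᵀ (1 - N)`, with `N` replaced by `s⁻¹ N(y)`. So `g^s` is the Euclidean
metric plus `s⁻¹ h(y)` plus a term of order `s⁻²`, where `h = -(N + Nᵀ)`. A vertical derivative
costs a factor `s`, a horizontal one costs nothing. Hence the curvature is `s` times a polynomial in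
`s⁻¹` with coefficients smooth in `y`, whose constant term is the curvature linearized in `h` with
vertical derivatives only (`hasLeadingTerm_curvature`).

After the change of variables `z ↦ y`, the integral in `a₂(g^s)` is a nonzero multiple of `P(s⁻¹)`
for a polynomial `P` with constant term `∫ linIntegrand h`. If that term is nonzero, `P` has
finitely many roots (`HasLeadingTerm.finite_integral_eq_zero`).

The tensor `h` is symmetric and trace free. It is divergence free in the vertical directions because
`ψ` is invariant under the rotations that generate the fields `Z*` (`sum_vertDeriv_connMatrix`). So
the linearized scalar curvature vanishes, the linearized Ricci tensor is `-½ Δh`, and integration by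
parts turns `∫ ‖R‖²` into `∫ ‖Δh‖²`, with `Δ` the vertical Laplacian. The constant term is therefore
`3/2 ∫ ‖Δh‖²` (`integral_linIntegrand`). It is positive, since a compactly supported function with
zero vertical Laplacian is zero, whereas `h ≠ 0`. -/

namespace HeatInvariant

/-! ### Polynomials in a parameter with smooth coefficients. -/

section LeadingTerm

/-- The algebra of smooth functions. -/
def smoothFunctions (E : Type*) [NormedAddCommGroup E] [NormedSpace ℝ E] :
    Subalgebra ℝ (E → ℝ) where
  carrier := {f | ContDiff ℝ ∞ f}
  mul_mem' {f f'} (hf : ContDiff ℝ ∞ f) (hf' : ContDiff ℝ ∞ f') := hf.mul hf'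
  add_mem' {f f'} (hf : ContDiff ℝ ∞ f) (hf' : ContDiff ℝ ∞ f') := hf.add hf'
  algebraMap_mem' c := show ContDiff ℝ ∞ fun _ => c from contDiff_const

/-- The evaluation of polynomials with smooth coefficients, as families of functions. -/
noncomputable def evalFamily (E : Type*) [NormedAddCommGroup E] [NormedSpace ℝ E] :
    Polynomial (smoothFunctions E) →ₐ[ℝ] (ℝ → E → ℝ) :=
  AlgHom.pi fun t => (smoothFunctions E).val.comp
    ((Polynomial.aeval (algebraMap ℝ (smoothFunctions E) t)).restrictScalars ℝ)

/-- Families `F t y` that are polynomial in `t` with coefficients smooth in `y`. -/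
noncomputable def polyFamilies (E : Type*) [NormedAddCommGroup E] [NormedSpace ℝ E] :
    Subalgebra ℝ (ℝ → E → ℝ) :=
  (evalFamily E).range

variable {E : Type*} [NormedAddCommGroup E] [NormedSpace ℝ E]

theorem evalFamily_apply (p : Polynomial (smoothFunctions E)) (t : ℝ) (y : E) :
    evalFamily E p t y = ∑ n ∈ Finset.range (p.natDegree + 1), t ^ n * (p.coeff n).1 y := by
  have h : evalFamily E p t = ((Polynomial.aeval (algebraMap ℝ (smoothFunctions E) t) p :
      smoothFunctions E) : E → ℝ) := rfl
  rw [h, Polynomial.aeval_eq_sum_range]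
  simp [Finset.sum_apply, mul_comm]

theorem const_mem_polyFamilies {f : E → ℝ} (hf : ContDiff ℝ ∞ f) :
    (fun _ => f) ∈ polyFamilies E := by
  refine ⟨Polynomial.C ⟨f, hf⟩, ?_⟩
  ext t y
  change evalFamily E _ t y = _
  simp [evalFamily_apply]

theorem param_mem_polyFamilies : (fun t _ => t) ∈ polyFamilies E := by
  refine ⟨Polynomial.X, ?_⟩
  ext t y
  change evalFamily E _ t y = _
  simp [evalFamily_apply, Finset.sum_range_succ]

theorem exists_sum_of_mem_polyFamilies {F : ℝ → E → ℝ} (hF : F ∈ polyFamilies E) :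
    ∃ (N : ℕ) (c : ℕ → E → ℝ), (∀ n, ContDiff ℝ ∞ (c n)) ∧
      ∀ t y, F t y = ∑ n ∈ Finset.range (N + 1), t ^ n * c n y := by
  obtain ⟨p, rfl⟩ := hF
  exact ⟨p.natDegree, fun n => (p.coeff n).1, fun n => (p.coeff n).2,
    fun t y => evalFamily_apply p t y⟩

theorem contDiff_of_mem_polyFamilies {F : ℝ → E → ℝ} (hF : F ∈ polyFamilies E) (t : ℝ) :
    ContDiff ℝ ∞ (F t) := by
  obtain ⟨N, c, hc, h⟩ := exists_sum_of_mem_polyFamilies hF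
  rw [show F t = fun y => ∑ n ∈ Finset.range (N + 1), t ^ n * c n y from funext (h t)]
  exact ContDiff.sum fun n _ => contDiff_const.mul (hc n)

theorem contDiff_fderiv_apply {f : E → ℝ} (hf : ContDiff ℝ ∞ f) (v : E) :
    ContDiff ℝ ∞ (fun y => fderiv ℝ f y v) :=
  (hf.fderiv_right (m := ∞) (by simp)).clm_apply contDiff_const

/-- Differentiation in `y` acts on the coefficients alone. With the subalgebra structure, this keeps
everything built from the metric by products and derivatives inside the class. -/
theorem fderiv_mem_polyFamilies {F : ℝ → E → ℝ} (hF : F ∈ polyFamilies E) (v : E) :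
    (fun t y => fderiv ℝ (F t) y v) ∈ polyFamilies E := by
  obtain ⟨N, c, hc, h⟩ := exists_sum_of_mem_polyFamilies hF
  have key : (fun t y => fderiv ℝ (F t) y v)
      = ∑ n ∈ Finset.range (N + 1), (fun t _ => t) ^ n * (fun _ y => fderiv ℝ (c n) y v) := by
    ext t y
    rw [show F t = fun y => ∑ n ∈ Finset.range (N + 1), t ^ n * c n y from funext (h t)]
    have hd : ∀ n, DifferentiableAt ℝ (c n) y := fun n =>
      (hc n).differentiable (by simp) y
    rw [fderiv_fun_sum fun n _ => (hd n).const_mul _]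
    simp [Finset.sum_apply, fderiv_const_mul (hd _)]
  rw [key]
  exact Subalgebra.sum_mem _ fun n _ => Subalgebra.mul_mem _
    (Subalgebra.pow_mem _ param_mem_polyFamilies n)
    (const_mem_polyFamilies (contDiff_fderiv_apply (hc n) v))

end LeadingTerm

/-! ### Leading terms as `s → ∞` under vertical scaling. -/

section Scaling

variable {α β : Type*} [Fintype α] [Fintype β]

/-- The map `(x, u) ↦ (x, s u)` of `ℝ^α × ℝ^β`. -/
noncomputable def scaleVert (s : ℝ) :
    EuclideanSpace ℝ (α ⊕ β) →L[ℝ] EuclideanSpace ℝ (α ⊕ β) :=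
  LinearMap.toContinuousLinearMap
    { toFun := fun z => WithLp.toLp 2 fun i => Sum.elim (fun _ => 1) (fun _ => s) i * z i
      map_add' := fun z w => by ext i; simp [mul_add]
      map_smul' := fun c z => by ext i; simp [mul_left_comm] }

@[simp] theorem scaleVert_inl (s : ℝ) (z : EuclideanSpace ℝ (α ⊕ β)) (i : α) :
    scaleVert s z (Sum.inl i) = z (Sum.inl i) := by
  simp [scaleVert]

@[simp] theorem scaleVert_inr (s : ℝ) (z : EuclideanSpace ℝ (α ⊕ β)) (q : β) :
    scaleVert s z (Sum.inr q) = s * z (Sum.inr q) := by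
  simp [scaleVert]

theorem scaleVert_scaleVert_inv {s : ℝ} (hs : s ≠ 0) (z : EuclideanSpace ℝ (α ⊕ β)) :
    scaleVert s (scaleVert s⁻¹ z) = z := by
  ext (i | q) <;> simp [hs]

/-- The family `Q s` is `s ^ e` times a polynomial in `s⁻¹` with smooth coefficients evaluated at
`(x, s u)`, and its leading coefficient is `Q₀`. -/
def HasLeadingTerm (e : ℤ) (Q : ℝ → EuclideanSpace ℝ (α ⊕ β) → ℝ)
    (Q₀ : EuclideanSpace ℝ (α ⊕ β) → ℝ) : Prop :=
  ∃ F ∈ polyFamilies (EuclideanSpace ℝ (α ⊕ β)), F 0 = Q₀ ∧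
    ∀ s, 0 < s → ∀ z, Q s z = s ^ e * F s⁻¹ (scaleVert s z)

namespace HasLeadingTerm

variable {e e' : ℤ} {Q Q' : ℝ → EuclideanSpace ℝ (α ⊕ β) → ℝ}
  {Q₀ Q₀' : EuclideanSpace ℝ (α ⊕ β) → ℝ}

theorem congr (h : HasLeadingTerm e Q Q₀) (he : e = e')
    (hQ : ∀ s, 0 < s → ∀ z, Q' s z = Q s z) (h₀ : ∀ z, Q₀' z = Q₀ z) :
    HasLeadingTerm e' Q' Q₀' := by
  obtain ⟨F, hF, rfl, hs⟩ := h
  subst he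
  exact ⟨F, hF, (funext h₀).symm, fun s h0 z => (hQ s h0 z).trans (hs s h0 z)⟩

theorem const (c : ℝ) : HasLeadingTerm 0 (fun _ (_ : EuclideanSpace ℝ (α ⊕ β)) => c)
    fun _ => c :=
  ⟨fun _ _ => c, const_mem_polyFamilies contDiff_const, rfl, by simp⟩

theorem add (h : HasLeadingTerm e Q Q₀) (h' : HasLeadingTerm e Q' Q₀') :
    HasLeadingTerm e (fun s z => Q s z + Q' s z) (fun z => Q₀ z + Q₀' z) := by
  obtain ⟨F, hF, rfl, hs⟩ := h
  obtain ⟨F', hF', rfl, hs'⟩ := h'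
  exact ⟨F + F', Subalgebra.add_mem _ hF hF', rfl, fun s h0 z => by
    simp [hs s h0, hs' s h0, mul_add]⟩

theorem mul (h : HasLeadingTerm e Q Q₀) (h' : HasLeadingTerm e' Q' Q₀') :
    HasLeadingTerm (e + e') (fun s z => Q s z * Q' s z) (fun z => Q₀ z * Q₀' z) := by
  obtain ⟨F, hF, rfl, hs⟩ := h
  obtain ⟨F', hF', rfl, hs'⟩ := h'
  exact ⟨F * F', Subalgebra.mul_mem _ hF hF', rfl, fun s h0 z => by
    simp only [hs s h0, hs' s h0, zpow_add₀ h0.ne', Pi.mul_apply]; ring⟩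

theorem const_mul (c : ℝ) (h : HasLeadingTerm e Q Q₀) :
    HasLeadingTerm e (fun s z => c * Q s z) (fun z => c * Q₀ z) :=
  ((HasLeadingTerm.const c).mul h).congr (zero_add e) (fun _ _ _ => rfl) fun _ => rfl

theorem neg (h : HasLeadingTerm e Q Q₀) :
    HasLeadingTerm e (fun s z => -Q s z) (fun z => -Q₀ z) :=
  (h.const_mul (-1)).congr rfl (by simp) (by simp)

theorem sub (h : HasLeadingTerm e Q Q₀) (h' : HasLeadingTerm e Q' Q₀') :
    HasLeadingTerm e (fun s z => Q s z - Q' s z) (fun z => Q₀ z - Q₀' z) :=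
  (h.add h'.neg).congr rfl (fun _ _ _ => sub_eq_add_neg _ _) fun _ => sub_eq_add_neg _ _

/-- With `t = s⁻¹`, `s ^ e * F = s ^ (e + 1) * (t F)`, and `t F` vanishes at `t = 0`. This is how
lower-order terms are absorbed into sums of higher order. -/
theorem raise (h : HasLeadingTerm e Q Q₀) : HasLeadingTerm (e + 1) Q fun _ => 0 := by
  obtain ⟨F, hF, rfl, hs⟩ := h
  refine ⟨(fun t _ => t) * F, Subalgebra.mul_mem _ param_mem_polyFamilies hF, ?_, ?_⟩
  · ext z; simp
  · intro s h0 z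
    simp only [hs s h0, zpow_add₀ h0.ne', Pi.mul_apply]
    field_simp

theorem sum {κ : Type*} (S : Finset κ) {Q : κ → ℝ → EuclideanSpace ℝ (α ⊕ β) → ℝ}
    {Q₀ : κ → EuclideanSpace ℝ (α ⊕ β) → ℝ} (h : ∀ i, HasLeadingTerm e (Q i) (Q₀ i)) :
    HasLeadingTerm e (fun s z => ∑ i ∈ S, Q i s z) (fun z => ∑ i ∈ S, Q₀ i z) := by
  choose F hF h0 hs using h
  refine ⟨∑ i ∈ S, F i, Subalgebra.sum_mem _ fun i _ => hF i, ?_, fun s hpos z => ?_⟩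
  · ext z; simp [h0]
  · simp [hs _ s hpos, Finset.mul_sum]

end HasLeadingTerm

variable [DecidableEq α] [DecidableEq β]

/-- The coordinate direction `∂ᵢ` if it is vertical, and `0` otherwise. -/
noncomputable def vertDir (i : α ⊕ β) : EuclideanSpace ℝ (α ⊕ β) :=
  Sum.elim (fun _ => 0) (fun q => EuclideanSpace.single (Sum.inr q) 1) i

/-- The derivative `∂ᵢ f` if the direction `i` is vertical, and `0` otherwise. -/
noncomputable def vertDeriv (i : α ⊕ β) (f : EuclideanSpace ℝ (α ⊕ β) → ℝ)
    (z : EuclideanSpace ℝ (α ⊕ β)) : ℝ :=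
  fderiv ℝ f z (vertDir i)

/-- By the chain rule a vertical derivative gains a factor `s`. A horizontal one gains none, so
relative to order `e + 1` it carries an extra `t = s⁻¹` and has leading coefficient zero. -/
theorem HasLeadingTerm.partialDeriv {e : ℤ} {Q : ℝ → EuclideanSpace ℝ (α ⊕ β) → ℝ}
    {Q₀ : EuclideanSpace ℝ (α ⊕ β) → ℝ} (h : HasLeadingTerm e Q Q₀) (i : α ⊕ β) :
    HasLeadingTerm (e + 1) (fun s => partialDeriv i (Q s)) (vertDeriv i Q₀) := by
  obtain ⟨F, hF, rfl, hs⟩ := h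
  have hd : ∀ s, 0 < s → ∀ z, HeatInvariant.partialDeriv i (Q s) z
      = s ^ e * fderiv ℝ (F s⁻¹) (scaleVert s z) (scaleVert s (EuclideanSpace.single i 1)) := by
    intro s h0 z
    have hd : DifferentiableAt ℝ (F s⁻¹) (scaleVert s z) :=
      (contDiff_of_mem_polyFamilies hF _).differentiable (by simp) _
    have := (hd.hasFDerivAt.comp z (scaleVert s).hasFDerivAt).const_mul (s ^ e)
    rw [HeatInvariant.partialDeriv, show Q s = fun z => s ^ e * (F s⁻¹ ∘ scaleVert s) z from
      funext (hs s h0), this.fderiv]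
    simp
  rcases i with i | q
  · have hv : ∀ s : ℝ, scaleVert s (EuclideanSpace.single (Sum.inl i : α ⊕ β) (1 : ℝ))
        = EuclideanSpace.single (Sum.inl i) 1 := by
      intro s; ext (j | q) <;> simp
    refine ⟨(fun t _ => t) * fun t y => fderiv ℝ (F t) y (EuclideanSpace.single (Sum.inl i) 1),
      Subalgebra.mul_mem _ param_mem_polyFamilies (fderiv_mem_polyFamilies hF _), ?_, ?_⟩
    · ext z; simp [vertDeriv, vertDir]
    · intro s h0 z
      simp only [hd s h0, hv, zpow_add₀ h0.ne', Pi.mul_apply]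
      field_simp
  · have hv : ∀ s : ℝ, scaleVert s (EuclideanSpace.single (Sum.inr q : α ⊕ β) (1 : ℝ))
        = s • EuclideanSpace.single (Sum.inr q) 1 := by
      intro s; ext (j | q') <;> simp
    refine ⟨fun t y => fderiv ℝ (F t) y (EuclideanSpace.single (Sum.inr q) 1),
      fderiv_mem_polyFamilies hF _, ?_, ?_⟩
    · ext z; simp [vertDeriv, vertDir]
    · intro s h0 z
      simp only [hd s h0, hv, zpow_add₀ h0.ne', zpow_one, map_smul, smul_eq_mul]
      ring

end Scaling

/-! ### The curvature to leading order is the linearized curvature. -/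

section LinearizedCurvature

variable {α β : Type*} [Fintype α] [Fintype β] [DecidableEq α] [DecidableEq β]

/-- The Christoffel symbols of the Euclidean metric perturbed by `h`, linearized in `h`, keeping
vertical derivatives only. -/
noncomputable def linChristoffel (h : α ⊕ β → α ⊕ β → EuclideanSpace ℝ (α ⊕ β) → ℝ)
    (l i j : α ⊕ β) (z : EuclideanSpace ℝ (α ⊕ β)) : ℝ :=
  (1 / 2 : ℝ) * (vertDeriv i (h j l) z + vertDeriv j (h i l) z - vertDeriv l (h i j) z)

/-- The linearized curvature tensor for vertical derivatives. -/
noncomputable def linCurvature (h : α ⊕ β → α ⊕ β → EuclideanSpace ℝ (α ⊕ β) → ℝ)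
    (l k i j : α ⊕ β) (z : EuclideanSpace ℝ (α ⊕ β)) : ℝ :=
  vertDeriv i (linChristoffel h l j k) z - vertDeriv j (linChristoffel h l i k) z

/-- The linearized Ricci tensor for vertical derivatives. -/
noncomputable def linRicci (h : α ⊕ β → α ⊕ β → EuclideanSpace ℝ (α ⊕ β) → ℝ)
    (a b : α ⊕ β) (z : EuclideanSpace ℝ (α ⊕ β)) : ℝ :=
  ∑ c, linCurvature h a c b c z

/-- The linearized scalar curvature for vertical derivatives. -/
noncomputable def linScalar (h : α ⊕ β → α ⊕ β → EuclideanSpace ℝ (α ⊕ β) → ℝ)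
    (z : EuclideanSpace ℝ (α ⊕ β)) : ℝ :=
  ∑ a, linRicci h a a z

/-- The quadratic form of the second heat invariant, evaluated on the linearized curvature. -/
noncomputable def linIntegrand (h : α ⊕ β → α ⊕ β → EuclideanSpace ℝ (α ⊕ β) → ℝ)
    (z : EuclideanSpace ℝ (α ⊕ β)) : ℝ :=
  5 * linScalar h z ^ 2 - 2 * (∑ a, ∑ b, linRicci h a b z ^ 2)
    + 2 * ∑ a, ∑ b, ∑ c, ∑ d, linCurvature h a b c d z ^ 2

variable {g : ℝ → EuclideanSpace ℝ (α ⊕ β) → Matrix (α ⊕ β) (α ⊕ β) ℝ}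
  {h : α ⊕ β → α ⊕ β → EuclideanSpace ℝ (α ⊕ β) → ℝ}
  (hg : ∀ i j, HasLeadingTerm (-1)
    (fun s z => g s z i j - (1 : Matrix (α ⊕ β) (α ⊕ β) ℝ) i j) (h i j))
  (hinv : ∀ i j, HasLeadingTerm 0 (fun s z => (g s z)⁻¹ i j)
    fun _ => (1 : Matrix (α ⊕ β) (α ⊕ β) ℝ) i j)

include hg in
theorem hasLeadingTerm_partialDeriv_metric (i j l : α ⊕ β) :
    HasLeadingTerm 0 (fun s => partialDeriv i fun y => g s y j l) (vertDeriv i (h j l)) :=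
  ((hg j l).partialDeriv i).congr (by norm_num)
    (fun s _ z => by simp only [partialDeriv]; rw [fderiv_sub_const]) fun _ => rfl

include hg in
theorem hasLeadingTerm_metric (i j : α ⊕ β) :
    HasLeadingTerm 0 (fun s z => g s z i j) fun _ => (1 : Matrix (α ⊕ β) (α ⊕ β) ℝ) i j :=
  ((hg i j).raise.add (HasLeadingTerm.const ((1 : Matrix (α ⊕ β) (α ⊕ β) ℝ) i j))).congr
    (by norm_num) (fun _ _ _ => (sub_add_cancel _ _).symm) fun _ => (zero_add _).symm

include hg hinv

theorem hasLeadingTerm_christoffel (l i j : α ⊕ β) :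
    HasLeadingTerm 0 (fun s => christoffel (g s) l i j) (linChristoffel h l i j) :=
  (HasLeadingTerm.const_mul (1 / 2) <| HasLeadingTerm.sum Finset.univ fun a =>
    (hinv l a).mul <| ((hasLeadingTerm_partialDeriv_metric hg i j a).add
      (hasLeadingTerm_partialDeriv_metric hg j i a)).sub
      (hasLeadingTerm_partialDeriv_metric hg a i j)).congr (by norm_num)
    (fun s _ z => rfl) fun z => by simp [linChristoffel, Matrix.one_apply]

/-- The Christoffel symbols have order 0, so their derivatives have order 1, while the quadratic
terms stay at order 0 and drop out of the leading coefficient. -/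
theorem hasLeadingTerm_curvatureUp (l k i j : α ⊕ β) :
    HasLeadingTerm 1 (fun s => curvatureUp (g s) l k i j) (linCurvature h l k i j) := by
  have hΓ := hasLeadingTerm_christoffel hg hinv
  exact ((((hΓ l j k).partialDeriv i).sub ((hΓ l i k).partialDeriv j)).add
    (HasLeadingTerm.sum Finset.univ fun p =>
      ((hΓ l i p).mul (hΓ p j k)).sub ((hΓ l j p).mul (hΓ p i k))).raise).congr (by norm_num)
    (fun s _ z => rfl) fun z => by simp [linCurvature]

theorem hasLeadingTerm_curvature (a b c d : α ⊕ β) :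
    HasLeadingTerm 1 (fun s => curvature (g s) a b c d) (linCurvature h a b c d) :=
  (HasLeadingTerm.sum Finset.univ fun l => (hasLeadingTerm_metric hg a l).mul
    (hasLeadingTerm_curvatureUp hg hinv l b c d)).congr (by norm_num)
    (fun s _ z => rfl) fun z => by simp [Matrix.one_apply]

theorem hasLeadingTerm_ricci (a b : α ⊕ β) :
    HasLeadingTerm 1 (fun s => ricci (g s) a b) (linRicci h a b) :=
  (HasLeadingTerm.sum Finset.univ fun c => HasLeadingTerm.sum Finset.univ fun d =>
    (hinv c d).mul (hasLeadingTerm_curvature hg hinv a c b d)).congr (by norm_num)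
    (fun s _ z => rfl) fun z => by simp [linRicci, Matrix.one_apply]

theorem hasLeadingTerm_scalarCurvature :
    HasLeadingTerm 1 (fun s => scalarCurvature (g s)) (linScalar h) :=
  (HasLeadingTerm.sum Finset.univ fun a => HasLeadingTerm.sum Finset.univ fun b =>
    (hinv a b).mul (hasLeadingTerm_ricci hg hinv a b)).congr (by norm_num)
    (fun s _ z => rfl) fun z => by simp [linScalar, Matrix.one_apply]

theorem hasLeadingTerm_ricciNormSq :
    HasLeadingTerm 2 (fun s => ricciNormSq (g s)) fun z => ∑ a, ∑ b, linRicci h a b z ^ 2 :=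
  (HasLeadingTerm.sum Finset.univ fun a => HasLeadingTerm.sum Finset.univ fun b =>
    HasLeadingTerm.sum Finset.univ fun a' => HasLeadingTerm.sum Finset.univ fun b' =>
    (((hinv a a').mul (hinv b b')).mul (hasLeadingTerm_ricci hg hinv a b)).mul
      (hasLeadingTerm_ricci hg hinv a' b')).congr (by norm_num)
    (fun s _ z => rfl) fun z => by simp [Matrix.one_apply, sq]

theorem hasLeadingTerm_curvatureNormSq :
    HasLeadingTerm 2 (fun s => curvatureNormSq (g s))
      fun z => ∑ a, ∑ b, ∑ c, ∑ d, linCurvature h a b c d z ^ 2 :=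
  (HasLeadingTerm.sum Finset.univ fun a => HasLeadingTerm.sum Finset.univ fun b =>
    HasLeadingTerm.sum Finset.univ fun c => HasLeadingTerm.sum Finset.univ fun d =>
    HasLeadingTerm.sum Finset.univ fun a' => HasLeadingTerm.sum Finset.univ fun b' =>
    HasLeadingTerm.sum Finset.univ fun c' => HasLeadingTerm.sum Finset.univ fun d' =>
    (((((hinv a a').mul (hinv b b')).mul (hinv c c')).mul (hinv d d')).mul
      (hasLeadingTerm_curvature hg hinv a b c d)).mul
      (hasLeadingTerm_curvature hg hinv a' b' c' d')).congr (by norm_num)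
    (fun s _ z => rfl) fun z => by simp [Matrix.one_apply, sq]

theorem hasLeadingTerm_integrand (hdet : ∀ s, 0 < s → ∀ z, (g s z).det = 1) :
    HasLeadingTerm 2 (fun s z => (5 * scalarCurvature (g s) z ^ 2 - 2 * ricciNormSq (g s) z
      + 2 * curvatureNormSq (g s) z) * Real.sqrt (g s z).det) (linIntegrand h) := by
  have hτ := hasLeadingTerm_scalarCurvature hg hinv
  exact ((((hτ.mul hτ).const_mul 5).sub
    ((hasLeadingTerm_ricciNormSq hg hinv).const_mul 2)).add
    ((hasLeadingTerm_curvatureNormSq hg hinv).const_mul 2)).congr (by norm_num)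
    (fun s hs z => by simp [hdet s hs z, sq]) fun z => by simp [linIntegrand, sq]

end LinearizedCurvature

/-! ### Vanishing of the integrand where the metric is locally constant. -/

section Locality

variable {ι : Type*} [Fintype ι] [DecidableEq ι]

theorem integrand_eq_zero_of_eventuallyEq {g : EuclideanSpace ℝ ι → Matrix ι ι ℝ}
    {z : EuclideanSpace ℝ ι} {M : Matrix ι ι ℝ} (hg : g =ᶠ[nhds z] fun _ => M) :
    (5 * scalarCurvature g z ^ 2 - 2 * ricciNormSq g z + 2 * curvatureNormSq g z)
      * Real.sqrt (g z).det = 0 := by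
  have hd : ∀ i (f : EuclideanSpace ℝ ι → ℝ) (y : EuclideanSpace ℝ ι) (c : ℝ),
      f =ᶠ[nhds y] (fun _ => c) → partialDeriv i f y = 0 := by
    intro i f y c h
    rw [partialDeriv, h.fderiv_eq]
    simp
  have hΓ : ∀ l i j, christoffel g l i j =ᶠ[nhds z] fun _ => 0 := by
    intro l i j
    filter_upwards [hg.eventuallyEq_nhds] with y hy
    have h : ∀ i j a, partialDeriv i (fun y => g y j a) y = 0 := fun i j a =>
      hd i _ y (M j a) (hy.mono fun w hw => by simp [hw])
    simp [christoffel, h]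
  have hR : ∀ a b c d, curvature g a b c d z = 0 := by
    intro a b c d
    simp [curvature, curvatureUp, hd _ _ z 0 (hΓ _ _ _), (hΓ _ _ _).eq_of_nhds]
  simp [scalarCurvature, ricciNormSq, curvatureNormSq, ricci, hR]

end Locality

/-! ### The integral of the linearized integrand, by integration by parts. -/

section LinearizedIntegral

variable {α β : Type*} [Fintype α] [Fintype β]

/-- Smooth functions with compact support. -/
def IsTest (f : EuclideanSpace ℝ (α ⊕ β) → ℝ) : Prop := ContDiff ℝ ∞ f ∧ HasCompactSupport f

namespace IsTest

variable {f f' : EuclideanSpace ℝ (α ⊕ β) → ℝ}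

theorem differentiable (hf : IsTest f) : Differentiable ℝ f := hf.1.differentiable (by simp)

theorem mul (hf : IsTest f) (hf' : IsTest f') : IsTest fun z => f z * f' z :=
  ⟨hf.1.mul hf'.1, hf.2.mul_right⟩

theorem add (hf : IsTest f) (hf' : IsTest f') : IsTest fun z => f z + f' z :=
  ⟨hf.1.add hf'.1, hf.2.add hf'.2⟩

theorem neg (hf : IsTest f) : IsTest fun z => -f z :=
  ⟨hf.1.neg, hf.2.comp_left (g := fun x => -x) neg_zero⟩

theorem sub (hf : IsTest f) (hf' : IsTest f') : IsTest fun z => f z - f' z := by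
  simpa only [sub_eq_add_neg] using hf.add hf'.neg

theorem zero : IsTest fun _ : EuclideanSpace ℝ (α ⊕ β) => (0 : ℝ) :=
  ⟨contDiff_const, HasCompactSupport.zero⟩

theorem sum {κ : Type*} (S : Finset κ) {f : κ → EuclideanSpace ℝ (α ⊕ β) → ℝ}
    (hf : ∀ i, IsTest (f i)) : IsTest fun z => ∑ i ∈ S, f i z := by
  classical
  induction S using Finset.induction_on with
  | empty => simpa using zero
  | insert i S hi ih => simpa [Finset.sum_insert hi] using (hf i).add ih

theorem integrable (hf : IsTest f) : Integrable f :=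
  hf.1.continuous.integrable_of_hasCompactSupport hf.2

theorem eq_zero_of_integral_sq (hf : IsTest f) (h : ∫ z, f z * f z = 0) (z) : f z = 0 := by
  by_contra hz
  exact (((hf.mul hf).1.continuous).integral_pos_of_hasCompactSupport_nonneg_nonzero
    (μ := volume) (hf.mul hf).2 (fun z => mul_self_nonneg _) (mul_self_ne_zero.2 hz)).ne' h

theorem sum_integral_mul_eq_zero {κ : Type*} (S : Finset κ)
    {F : κ → EuclideanSpace ℝ (α ⊕ β) → ℝ} (hF : ∀ i, IsTest (F i)) (hf : IsTest f)
    (h : ∀ z, ∑ i ∈ S, F i z = 0) : ∑ i ∈ S, ∫ z, F i z * f z = 0 := by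
  rw [← integral_finsetSum S fun i _ => ((hF i).mul hf).integrable]
  simp [← Finset.sum_mul, h]

end IsTest

variable [DecidableEq α] [DecidableEq β]

theorem contDiff_vertDeriv {f : EuclideanSpace ℝ (α ⊕ β) → ℝ} (hf : ContDiff ℝ ∞ f) (i : α ⊕ β) :
    ContDiff ℝ ∞ (vertDeriv i f) :=
  contDiff_fderiv_apply hf _

theorem vertDeriv_comm {f : EuclideanSpace ℝ (α ⊕ β) → ℝ} (hf : ContDiff ℝ ∞ f) (i j : α ⊕ β) :
    vertDeriv i (vertDeriv j f) = vertDeriv j (vertDeriv i f) := by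
  have key : ∀ i j z, vertDeriv i (vertDeriv j f) z
      = fderiv ℝ (fderiv ℝ f) z (vertDir i) (vertDir j) := by
    intro i j z
    have hd : DifferentiableAt ℝ (fderiv ℝ f) z :=
      (hf.fderiv_right (m := ∞) (by simp)).differentiable (by simp) z
    change fderiv ℝ (fun y => fderiv ℝ f y (vertDir j)) z (vertDir i) = _
    rw [fderiv_clm_apply hd (differentiableAt_const _)]
    simp
  ext z
  rw [key, key]
  exact ((contDiff_infty.1 hf 2).contDiffAt.isSymmSndFDerivAt
    (by simp)).eq _ _

/-- Used to differentiate the divergence and trace identities for `h`. -/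
theorem sum_vertDeriv_eq_zero {κ : Type*} [Fintype κ] (a : α ⊕ β)
    {F : κ → EuclideanSpace ℝ (α ⊕ β) → ℝ} (hF : ∀ c, ContDiff ℝ ∞ (F c))
    (h0 : ∀ z, ∑ c, F c z = 0) (z) : ∑ c, vertDeriv a (F c) z = 0 := by
  have h := fderiv_fun_sum (𝕜 := ℝ) (u := Finset.univ) (A := F) (x := z) fun c _ =>
    (hF c).differentiable (by simp) z
  rw [show (fun z => ∑ c, F c z) = fun _ => 0 from funext h0] at h
  simpa [vertDeriv] using (congrArg (fun L => L (vertDir a)) h).symm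

section

variable {f f' : EuclideanSpace ℝ (α ⊕ β) → ℝ}

theorem IsTest.vertDeriv (hf : IsTest f) (i : α ⊕ β) : IsTest (vertDeriv i f) :=
  ⟨contDiff_vertDeriv hf.1 i, hf.2.fderiv_apply (𝕜 := ℝ) _⟩

theorem IsTest.integral_vertDeriv_mul (hf : IsTest f) (hf' : IsTest f') (i : α ⊕ β) :
    ∫ z, HeatInvariant.vertDeriv i f z * f' z = -∫ z, f z * HeatInvariant.vertDeriv i f' z := by
  have := integral_mul_fderiv_eq_neg_fderiv_mul_of_integrable (μ := volume)
    (v := vertDir i) ((hf.vertDeriv i).mul hf').integrable (hf.mul (hf'.vertDeriv i)).integrable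
    (hf.mul hf').integrable (fun x _ => hf.differentiable x) (fun x _ => hf'.differentiable x)
  simp only [HeatInvariant.vertDeriv]
  rw [this, neg_neg]

/-- Two integrations by parts exchange the outer derivatives. -/
theorem IsTest.integral_vertDeriv_exchange (hf : IsTest f) (hf' : IsTest f')
    (i j : α ⊕ β) :
    ∫ z, HeatInvariant.vertDeriv i f z * HeatInvariant.vertDeriv j f' z
      = ∫ z, HeatInvariant.vertDeriv j f z * HeatInvariant.vertDeriv i f' z := by
  rw [hf.integral_vertDeriv_mul (hf'.vertDeriv j), hf.integral_vertDeriv_mul (hf'.vertDeriv i),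
    vertDeriv_comm hf'.1]

/-- The Laplacian in the vertical variables. -/
noncomputable def vertLaplacian (f : EuclideanSpace ℝ (α ⊕ β) → ℝ)
    (z : EuclideanSpace ℝ (α ⊕ β)) : ℝ :=
  ∑ c, vertDeriv c (vertDeriv c f) z

theorem IsTest.vertLaplacian (hf : IsTest f) : IsTest (vertLaplacian f) :=
  IsTest.sum _ fun c => (hf.vertDeriv c).vertDeriv c

/-- The function is constant along the vertical line through `z`, and that line leaves the compact
support. -/
theorem IsTest.eq_zero_of_vertDeriv (hf : IsTest f) (q : β)
    (h : ∀ z, HeatInvariant.vertDeriv (Sum.inr q) f z = 0) (z) : f z = 0 := by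
  set v : EuclideanSpace ℝ (α ⊕ β) := EuclideanSpace.single (Sum.inr q) 1 with hv
  have hd : ∀ t : ℝ, HasDerivAt (fun t : ℝ => f (z + t • v)) 0 t := by
    intro t
    have h1 : HasDerivAt (fun t : ℝ => z + t • v) v t := by
      simpa using ((hasDerivAt_id t).smul_const v).const_add z
    have h2 := (hf.differentiable (z + t • v)).hasFDerivAt.comp_hasDerivAt t h1
    rwa [show fderiv ℝ f (z + t • v) v = 0 from h _] at h2
  have hc : ∀ t : ℝ, f (z + t • v) = f z := fun t => by
    simpa using is_const_of_deriv_eq_zero (fun t => (hd t).differentiableAt)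
      (fun t => (hd t).deriv) t 0
  obtain ⟨r, hr⟩ := hf.2.isCompact.isBounded.subset_closedBall 0
  -- The support lies in the ball of radius `r`; at this parameter the point has norm at least `r +
  -- 1`.
  rw [← hc (r + 1 + ‖z‖)]
  apply image_eq_zero_of_notMem_tsupport
  intro hmem
  have h1 := mem_closedBall_zero_iff.1 (hr hmem)
  have h2 : ‖(r + 1 + ‖z‖) • v‖ - ‖z‖ ≤ ‖z + (r + 1 + ‖z‖) • v‖ := by
    have := norm_sub_norm_le ((r + 1 + ‖z‖) • v) (-z)
    rwa [norm_neg, sub_neg_eq_add, add_comm ((r + 1 + ‖z‖) • v) z] at this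
  have h3 : ‖v‖ = 1 := by simp [hv]
  rw [norm_smul, h3, mul_one, Real.norm_eq_abs] at h2
  have := le_abs_self (r + 1 + ‖z‖)
  linarith

/-- Pairing with `f` and integrating by parts gives `∑ ∫ (∂f)² = 0`, so every vertical derivative
vanishes; the index `q` provides one. -/
theorem IsTest.eq_zero_of_vertLaplacian (hf : IsTest f) (q : β)
    (h : ∀ z, HeatInvariant.vertLaplacian f z = 0) (z) : f z = 0 := by
  have h1 : ∑ c, ∫ z, HeatInvariant.vertDeriv c (HeatInvariant.vertDeriv c f) z * f z = 0 :=
    IsTest.sum_integral_mul_eq_zero _ (fun c => (hf.vertDeriv c).vertDeriv c) hf h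
  simp only [(hf.vertDeriv _).integral_vertDeriv_mul hf, Finset.sum_neg_distrib,
    neg_eq_zero] at h1
  rw [Finset.sum_eq_zero_iff_of_nonneg
    fun c _ => integral_nonneg fun z => mul_self_nonneg _] at h1
  exact hf.eq_zero_of_vertDeriv q
    ((hf.vertDeriv _).eq_zero_of_integral_sq (h1 (Sum.inr q) (Finset.mem_univ _))) z

end

variable {h : α ⊕ β → α ⊕ β → EuclideanSpace ℝ (α ⊕ β) → ℝ}

/-- The terms `∂ᵢ∂ⱼ h k l` in the two Christoffel derivatives cancel by commutation. -/
theorem linCurvature_eq (hc : ∀ i j, ContDiff ℝ ∞ (h i j))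
    (l k i j : α ⊕ β) (z : EuclideanSpace ℝ (α ⊕ β)) :
    linCurvature h l k i j z = (1 / 2 : ℝ) * (vertDeriv i (vertDeriv k (h j l)) z
      - vertDeriv i (vertDeriv l (h j k)) z - vertDeriv j (vertDeriv k (h i l)) z
      + vertDeriv j (vertDeriv l (h i k)) z) := by
  have hd : ∀ i j k, DifferentiableAt ℝ (vertDeriv i (h j k)) z := fun i j k =>
    (contDiff_vertDeriv (hc j k) i).differentiable (by simp) z
  have hΓ : ∀ a b c d, vertDeriv a (linChristoffel h b c d) z
      = (1 / 2 : ℝ) * (vertDeriv a (vertDeriv c (h d b)) z + vertDeriv a (vertDeriv d (h c b)) z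
        - vertDeriv a (vertDeriv b (h c d)) z) := by
    intro a b c d
    have := ((((hd c d b).hasFDerivAt.add (hd d c b).hasFDerivAt).sub
      (hd b c d).hasFDerivAt).const_mul (1 / 2)).fderiv
    change fderiv ℝ (fun y => (1 / 2 : ℝ) * ((vertDeriv c (h d b) y + vertDeriv d (h c b) y)
      - vertDeriv b (h c d) y)) z (vertDir a) = _
    erw [this]
    simp [vertDeriv]
  rw [linCurvature, hΓ, hΓ, vertDeriv_comm (hc k l) j i]
  ring

/-- Of the four second-derivative terms, contraction turns two into derivatives of the divergence
and one into a second derivative of the trace. Only the Laplacian survives. -/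
theorem linRicci_eq (hc : ∀ i j, ContDiff ℝ ∞ (h i j)) (hsymm : ∀ i j, h i j = h j i)
    (hdiv : ∀ i z, ∑ j, vertDeriv j (h i j) z = 0) (htr : ∀ z, ∑ j, h j j z = 0)
    (a b : α ⊕ β) (z : EuclideanSpace ℝ (α ⊕ β)) :
    linRicci h a b z = -(1 / 2 : ℝ) * vertLaplacian (h b a) z := by
  simp only [linRicci, linCurvature_eq hc, vertLaplacian, ← Finset.mul_sum,
    Finset.sum_add_distrib, Finset.sum_sub_distrib]
  have h1 : ∑ c, vertDeriv b (vertDeriv c (h c a)) z = 0 :=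
    sum_vertDeriv_eq_zero b (fun c => contDiff_vertDeriv (hc c a) c) (fun z => by
      simpa only [hsymm _ a] using hdiv a z) z
  have h2 : ∑ c, vertDeriv b (vertDeriv a (h c c)) z = 0 := by
    exact sum_vertDeriv_eq_zero b (fun c => contDiff_vertDeriv (hc c c) a)
      (sum_vertDeriv_eq_zero a (fun c => hc c c) htr) z
  have h3 : ∑ c, vertDeriv c (vertDeriv a (h b c)) z = 0 := by
    simp only [vertDeriv_comm (hc _ _) _ a]
    exact sum_vertDeriv_eq_zero a (fun c => contDiff_vertDeriv (hc b c) c) (hdiv b) z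
  rw [h1, h2, h3]
  ring

/-- The squared norm of the tensor built from `P` by antisymmetrization in two pairs of indices. -/
theorem sum_antisymm_sq {κ : Type*} [Fintype κ] (P : κ → κ → κ → κ → ℝ) :
    ∑ l, ∑ k, ∑ i, ∑ j, ((1 / 2 : ℝ) * (P i k j l - P i l j k - P j k i l + P j l i k)) ^ 2
      = ∑ l, ∑ k, ∑ i, ∑ j, (P i k j l - P i l j k - P j k i l + P j l i k) * P i k j l := by
  set Q : κ → κ → κ → κ → ℝ := fun l k i j => P i k j l - P i l j k - P j k i l + P j l i k with hQ
  have hlk : ∀ l k i j, Q k l i j = -Q l k i j := fun l k i j => by simp only [hQ]; ring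
  have hij : ∀ l k i j, Q l k j i = -Q l k i j := fun l k i j => by simp only [hQ]; ring
  have swap : ∀ X : κ → κ → κ → κ → ℝ, ∑ l, ∑ k, ∑ i, ∑ j, Q l k i j * X l k i j
      = -∑ l, ∑ k, ∑ i, ∑ j, Q l k i j * X k l i j := by
    intro X
    rw [Finset.sum_comm]
    simp only [← Finset.sum_neg_distrib]
    refine Finset.sum_congr rfl fun l _ => Finset.sum_congr rfl fun k _ =>
      Finset.sum_congr rfl fun i _ => Finset.sum_congr rfl fun j _ => ?_
    rw [hlk, neg_mul]
  have swap' : ∀ X : κ → κ → κ → κ → ℝ, ∑ l, ∑ k, ∑ i, ∑ j, Q l k i j * X l k i j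
      = -∑ l, ∑ k, ∑ i, ∑ j, Q l k i j * X l k j i := by
    intro X
    simp only [← Finset.sum_neg_distrib]
    refine Finset.sum_congr rfl fun l _ => Finset.sum_congr rfl fun k _ => ?_
    rw [Finset.sum_comm]
    refine Finset.sum_congr rfl fun i _ => Finset.sum_congr rfl fun j _ => ?_
    rw [hij, neg_mul]
  -- By antisymmetry of `Q` in each pair, relabelling turns the four signed products in the expanded
  -- square into equal sums; four copies cancel the factor `1/4`.
  have e2 := swap fun l k i j => P i l j k
  have e3 := swap' fun l k i j => P j k i l
  have e4 := swap fun l k i j => P j l i k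
  have hexp : ∀ l k i j, ((1 / 2 : ℝ) * Q l k i j) ^ 2 = (1 / 4 : ℝ) * (Q l k i j * P i k j l
      - Q l k i j * P i l j k - Q l k i j * P j k i l + Q l k i j * P j l i k) := by
    intro l k i j
    simp only [hQ]
    ring
  change ∑ l, ∑ k, ∑ i, ∑ j, ((1 / 2 : ℝ) * Q l k i j) ^ 2
    = ∑ l, ∑ k, ∑ i, ∑ j, Q l k i j * P i k j l
  simp only [hexp, ← Finset.mul_sum, Finset.sum_add_distrib, Finset.sum_sub_distrib]
  rw [e2, e4, e3]
  ring

/-- After the reduction of `sum_antisymm_sq`, the diagonal products integrate to squares of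
Laplacians. Each of the three mixed sums contains a divergence of `h` once outer derivatives are
exchanged between the factors. -/
theorem integral_sum_linCurvature_sq (ht : ∀ i j, IsTest (h i j))
    (hsymm : ∀ i j, h i j = h j i) (hdiv : ∀ i z, ∑ j, vertDeriv j (h i j) z = 0) :
    ∫ z, ∑ l, ∑ k, ∑ i, ∑ j, linCurvature h l k i j z ^ 2
      = ∑ l, ∑ j, ∫ z, vertLaplacian (h j l) z * vertLaplacian (h j l) z := by
  have hP : ∀ i k j l, IsTest (vertDeriv i (vertDeriv k (h j l))) := fun i k j l =>
    ((ht j l).vertDeriv k).vertDeriv i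
  have hc := fun i j => (ht i j).1
  have hex : ∀ i k j l a b c d,
      ∫ z, vertDeriv i (vertDeriv k (h j l)) z * vertDeriv a (vertDeriv b (h c d)) z
        = ∫ z, vertDeriv a (vertDeriv k (h j l)) z * vertDeriv i (vertDeriv b (h c d)) z :=
    fun i k j l a b c d => ((ht j l).vertDeriv k).integral_vertDeriv_exchange
      ((ht c d).vertDeriv b) i a
  have hdiv' : ∀ (a i : α ⊕ β) z, ∑ j, vertDeriv a (vertDeriv j (h i j)) z = 0 :=
    fun a i => sum_vertDeriv_eq_zero a (fun j => contDiff_vertDeriv (hc i j) j) (hdiv i)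
  simp only [linCurvature_eq hc]
  simp only [sum_antisymm_sq fun i k j l => vertDeriv i (vertDeriv k (h j l)) _]
  have hsum : ∫ z, ∑ l, ∑ k, ∑ i, ∑ j, (vertDeriv i (vertDeriv k (h j l)) z
      - vertDeriv i (vertDeriv l (h j k)) z - vertDeriv j (vertDeriv k (h i l)) z
      + vertDeriv j (vertDeriv l (h i k)) z) * vertDeriv i (vertDeriv k (h j l)) z
      = ∑ l, ∑ k, ∑ i, ∑ j,
        ((∫ z, vertDeriv i (vertDeriv k (h j l)) z * vertDeriv i (vertDeriv k (h j l)) z)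
        - (∫ z, vertDeriv i (vertDeriv l (h j k)) z * vertDeriv i (vertDeriv k (h j l)) z)
        - (∫ z, vertDeriv j (vertDeriv k (h i l)) z * vertDeriv i (vertDeriv k (h j l)) z)
        + ∫ z, vertDeriv j (vertDeriv l (h i k)) z * vertDeriv i (vertDeriv k (h j l)) z) := by
    have hterm : ∀ l k i j, IsTest fun z => (vertDeriv i (vertDeriv k (h j l)) z
      - vertDeriv i (vertDeriv l (h j k)) z - vertDeriv j (vertDeriv k (h i l)) z
      + vertDeriv j (vertDeriv l (h i k)) z) * vertDeriv i (vertDeriv k (h j l)) z :=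
      fun l k i j => ((((hP i k j l).sub (hP i l j k)).sub (hP j k i l)).add (hP j l i k)).mul
        (hP i k j l)
    rw [integral_finsetSum _ fun l _ => (IsTest.sum _ fun k => IsTest.sum _ fun i =>
      IsTest.sum _ fun j => hterm l k i j).integrable]
    refine Finset.sum_congr rfl fun l _ => ?_
    rw [integral_finsetSum _ fun k _ => (IsTest.sum _ fun i =>
      IsTest.sum _ fun j => hterm l k i j).integrable]
    refine Finset.sum_congr rfl fun k _ => ?_
    rw [integral_finsetSum _ fun i _ => (IsTest.sum _ fun j => hterm l k i j).integrable]
    refine Finset.sum_congr rfl fun i _ => ?_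
    rw [integral_finsetSum _ fun j _ => (hterm l k i j).integrable]
    refine Finset.sum_congr rfl fun j _ => ?_
    have i1 := ((hP i k j l).mul (hP i k j l))
    have i2 := ((hP i l j k).mul (hP i k j l))
    have i3 := ((hP j k i l).mul (hP i k j l))
    have i4 := ((hP j l i k).mul (hP i k j l))
    simp only [add_mul, sub_mul]
    rw [integral_add ((i1.sub i2).sub i3).integrable i4.integrable,
      integral_sub (i1.sub i2).integrable i3.integrable,
      integral_sub i1.integrable i2.integrable]
  rw [hsum]
  simp only [Finset.sum_add_distrib, Finset.sum_sub_distrib]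
  -- Exchanging `∂ₗ` and `∂ₖ` puts `∂ₖ` on `h j k`, and the sum over `k` is a derivative of a
  -- divergence.
  have t2 : ∑ l, ∑ k, ∑ i, ∑ j,
      ∫ z, vertDeriv i (vertDeriv l (h j k)) z * vertDeriv i (vertDeriv k (h j l)) z = 0 := by
    refine Finset.sum_eq_zero fun l _ => ?_
    rw [Finset.sum_comm]
    refine Finset.sum_eq_zero fun i _ => ?_
    rw [Finset.sum_comm]
    refine Finset.sum_eq_zero fun j _ => ?_
    have : ∀ k, ∫ z, vertDeriv i (vertDeriv l (h j k)) z * vertDeriv i (vertDeriv k (h j l)) z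
        = ∫ z, vertDeriv i (vertDeriv k (h j k)) z * vertDeriv l (vertDeriv i (h j l)) z := by
      intro k
      rw [vertDeriv_comm (hc j k) i l, vertDeriv_comm (hc j l) i k, hex,
        vertDeriv_comm (hc j k) k i]
    simp only [this]
    exact IsTest.sum_integral_mul_eq_zero _ (fun k => hP i k j k) (hP l i j l) (hdiv' i j)
  -- Here, and in the next sum, exchanging `∂ᵢ` and `∂ⱼ` creates a divergence in the index `i`.
  have t3 : ∑ l, ∑ k, ∑ i, ∑ j,
      ∫ z, vertDeriv j (vertDeriv k (h i l)) z * vertDeriv i (vertDeriv k (h j l)) z = 0 := by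
    refine Finset.sum_eq_zero fun l _ => Finset.sum_eq_zero fun k _ => ?_
    rw [Finset.sum_comm]
    refine Finset.sum_eq_zero fun j _ => ?_
    have : ∀ i, ∫ z, vertDeriv j (vertDeriv k (h i l)) z * vertDeriv i (vertDeriv k (h j l)) z
        = ∫ z, vertDeriv k (vertDeriv i (h l i)) z * vertDeriv j (vertDeriv k (h j l)) z := by
      intro i
      rw [hex, vertDeriv_comm (hc i l) i k, hsymm i l]
    simp only [this]
    exact IsTest.sum_integral_mul_eq_zero _ (fun i => hP k i l i) (hP j k j l) (hdiv' k l)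
  have t4 : ∑ l, ∑ k, ∑ i, ∑ j,
      ∫ z, vertDeriv j (vertDeriv l (h i k)) z * vertDeriv i (vertDeriv k (h j l)) z = 0 := by
    refine Finset.sum_eq_zero fun l _ => Finset.sum_eq_zero fun k _ => ?_
    rw [Finset.sum_comm]
    refine Finset.sum_eq_zero fun j _ => ?_
    have : ∀ i, ∫ z, vertDeriv j (vertDeriv l (h i k)) z * vertDeriv i (vertDeriv k (h j l)) z
        = ∫ z, vertDeriv l (vertDeriv i (h k i)) z * vertDeriv j (vertDeriv k (h j l)) z := by
      intro i
      rw [hex, vertDeriv_comm (hc i k) i l, hsymm i k]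
    simp only [this]
    exact IsTest.sum_integral_mul_eq_zero _ (fun i => hP l i k i) (hP j k j l) (hdiv' l k)
  rw [t2, t3, t4, sub_zero, sub_zero, add_zero]
  refine Finset.sum_congr rfl fun l _ => ?_
  have t1 : ∀ k i j,
      ∫ z, vertDeriv i (vertDeriv k (h j l)) z * vertDeriv i (vertDeriv k (h j l)) z
        = ∫ z, vertDeriv k (vertDeriv k (h j l)) z * vertDeriv i (vertDeriv i (h j l)) z := by
    intro k i j
    conv_lhs => enter [2, z, 2]; rw [vertDeriv_comm (hc j l) i k]
    rw [hex]
  have hL : ∀ j, ∫ z, vertLaplacian (h j l) z * vertLaplacian (h j l) z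
      = ∑ k, ∑ i, ∫ z, vertDeriv k (vertDeriv k (h j l)) z * vertDeriv i (vertDeriv i (h j l)) z := by
    intro j
    simp only [vertLaplacian, Finset.sum_mul_sum]
    rw [integral_finsetSum _ fun k _ => (IsTest.sum _ fun i =>
      (hP k k j l).mul (hP i i j l)).integrable]
    refine Finset.sum_congr rfl fun k _ => ?_
    rw [integral_finsetSum _ fun i _ => ((hP k k j l).mul (hP i i j l)).integrable]
  simp only [hL]
  calc _ = ∑ k, ∑ j, ∑ i, ∫ z, vertDeriv k (vertDeriv k (h j l)) z
        * vertDeriv i (vertDeriv i (h j l)) z :=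
        Finset.sum_congr rfl fun k _ => Finset.sum_comm.trans <|
          Finset.sum_congr rfl fun j _ => Finset.sum_congr rfl fun i _ => t1 k i j
    _ = _ := Finset.sum_comm

/-- The scalar curvature drops out. The Ricci term contributes `-2 · 1/4` and the curvature term
`2`, which gives the constant `3/2`. -/
theorem integral_linIntegrand (ht : ∀ i j, IsTest (h i j))
    (hsymm : ∀ i j, h i j = h j i) (hdiv : ∀ i z, ∑ j, vertDeriv j (h i j) z = 0)
    (htr : ∀ z, ∑ j, h j j z = 0) :
    ∫ z, linIntegrand h z
      = 3 / 2 * ∑ l, ∑ j, ∫ z, vertLaplacian (h j l) z * vertLaplacian (h j l) z := by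
  have hc := fun i j => (ht i j).1
  have hric := linRicci_eq hc hsymm hdiv htr
  have hscal : ∀ z, linScalar h z = 0 := by
    intro z
    have hd : ∀ c, ∑ a, vertDeriv c (vertDeriv c (h a a)) z = 0 := fun c =>
      sum_vertDeriv_eq_zero c (fun a => contDiff_vertDeriv (hc a a) c)
        (sum_vertDeriv_eq_zero c (fun a => hc a a) htr) z
    simp only [linScalar, hric, vertLaplacian, ← Finset.mul_sum]
    rw [Finset.sum_comm]
    simp [hd]
  have hsq : ∀ a b, IsTest fun z => vertLaplacian (h b a) z * vertLaplacian (h b a) z :=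
    fun a b => (ht b a).vertLaplacian.mul (ht b a).vertLaplacian
  have hcurv : IsTest fun z => ∑ a, ∑ b, ∑ c, ∑ d, linCurvature h a b c d z ^ 2 := by
    refine IsTest.sum _ fun a => IsTest.sum _ fun b => IsTest.sum _ fun c => IsTest.sum _ fun d => ?_
    have hΓ : ∀ l i j, IsTest (linChristoffel h l i j) := fun l i j =>
      ⟨contDiff_const.mul ((((ht j l).vertDeriv i).add ((ht i l).vertDeriv j)).sub
        ((ht i j).vertDeriv l)).1, ((((ht j l).vertDeriv i).add ((ht i l).vertDeriv j)).sub
        ((ht i j).vertDeriv l)).2.mul_left⟩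
    have := ((hΓ a d b).vertDeriv c).sub ((hΓ a c b).vertDeriv d)
    simpa only [sq, linCurvature] using this.mul this
  have heq : ∀ z, linIntegrand h z
      = -(1 / 2 : ℝ) * (∑ a, ∑ b, vertLaplacian (h b a) z * vertLaplacian (h b a) z)
        + 2 * ∑ a, ∑ b, ∑ c, ∑ d, linCurvature h a b c d z ^ 2 := by
    intro z
    have : ∀ a b, linRicci h a b z ^ 2
        = (1 / 4 : ℝ) * (vertLaplacian (h b a) z * vertLaplacian (h b a) z) := fun a b => by
      rw [hric]; ring
    simp only [linIntegrand, hscal, this, ← Finset.mul_sum]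
    ring
  have hlap : IsTest fun z => ∑ a, ∑ b, vertLaplacian (h b a) z * vertLaplacian (h b a) z :=
    IsTest.sum _ fun a => IsTest.sum _ fun b => hsq a b
  simp only [heq]
  rw [integral_add (hlap.integrable.const_mul _) (hcurv.integrable.const_mul _),
    integral_const_mul, integral_const_mul, integral_sum_linCurvature_sq ht hsymm hdiv,
    integral_finsetSum _ fun a _ => (IsTest.sum _ fun b => hsq a b).integrable]
  simp only [integral_finsetSum _ fun b _ => (hsq _ b).integrable]
  ring

theorem integral_linIntegrand_ne_zero (ht : ∀ i j, IsTest (h i j))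
    (hsymm : ∀ i j, h i j = h j i) (hdiv : ∀ i z, ∑ j, vertDeriv j (h i j) z = 0)
    (htr : ∀ z, ∑ j, h j j z = 0) (q : β) {i j : α ⊕ β} {z : EuclideanSpace ℝ (α ⊕ β)}
    (hz : h i j z ≠ 0) : ∫ z, linIntegrand h z ≠ 0 := by
  rw [integral_linIntegrand ht hsymm hdiv htr]
  intro h0
  have hnn : ∀ l j, 0 ≤ ∫ z, vertLaplacian (h j l) z * vertLaplacian (h j l) z := fun l j =>
    integral_nonneg fun z => mul_self_nonneg _
  replace h0 := (mul_eq_zero.1 h0).resolve_left (by norm_num)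
  rw [Finset.sum_eq_zero_iff_of_nonneg fun l _ => Finset.sum_nonneg fun j _ => hnn l j] at h0
  have h1 := h0 j (Finset.mem_univ _)
  rw [Finset.sum_eq_zero_iff_of_nonneg fun i _ => hnn j i] at h1
  exact hz ((ht i j).eq_zero_of_vertLaplacian q
    ((ht i j).vertLaplacian.eq_zero_of_integral_sq (h1 i (Finset.mem_univ _))) z)

end LinearizedIntegral

/-! ### The matrix of the metric and its connection part. -/

section Connection

variable {m k : ℕ}
  (b : EuclideanSpace ℝ (Fin m) →ₗ[ℝ] EuclideanSpace ℝ (Fin m) →ₗ[ℝ] EuclideanSpace ℝ (Fin k))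
  (φ : ℝ × ℝ → ℝ)

/-- The function `ψ(x, u) = φ(‖x‖², ‖u‖²)`. -/
noncomputable def radial (z : Total m k) : ℝ := φ (‖xPart z‖ ^ 2, ‖uPart z‖ ^ 2)

/-- The vertical components of the horizontal lifts of the coordinate vectors. -/
noncomputable def connBlock (z : Total m k) : Matrix (Fin k × Fin 2) (Fin m) ℝ :=
  Matrix.of fun q i => shift b φ z (EuclideanSpace.single i 1) q

/-- `connBlock` as a strictly triangular matrix. -/
noncomputable def connMatrix (z : Total m k) :
    Matrix (Fin m ⊕ Fin k × Fin 2) (Fin m ⊕ Fin k × Fin 2) ℝ :=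
  Matrix.fromBlocks 0 0 (connBlock b φ z) 0

theorem connBlock_apply (z : Total m k) (p : Fin k) (j : Fin 2) (i : Fin m) :
    connBlock b φ z (p, j) i = radial φ z * (b (xPart z) (EuclideanSpace.single i 1) p
      * ![-z (Sum.inr (p, 1)), z (Sum.inr (p, 0))] j) := by
  fin_cases j <;> simp [connBlock, shift, fundVec_apply, radial, uPart]

theorem shift_zero (z : Total m k) : shift b φ z 0 = 0 := by
  ext ⟨p, j⟩
  fin_cases j <;> simp [shift, fundVec_apply]

theorem one_sub_connMatrix (z : Total m k) :
    1 - connMatrix b φ z = Matrix.fromBlocks 1 0 (-connBlock b φ z) 1 := by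
  ext (i | i) (j | j) <;> simp [connMatrix, Matrix.one_apply]

/-- The matrix `1 - N` sends `(Y, W)` to `(Y, W - ψ [x, Y]*)`, so the metric is the Euclidean one
pulled back by `1 - N`. -/
theorem metricMatrix_eq (z : Total m k) :
    metricMatrix b φ z = (1 - connMatrix b φ z).transpose * (1 - connMatrix b φ z) := by
  have hxl : ∀ i : Fin m, xPart (EuclideanSpace.single (Sum.inl i) 1 : Total m k)
      = EuclideanSpace.single i 1 := fun i => by
    ext j; simp [xPart]
  have hxr : ∀ q, xPart (EuclideanSpace.single (Sum.inr q) 1 : Total m k) = 0 := fun q => by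
    ext j; simp [xPart]
  have hul : ∀ i : Fin m, uPart (EuclideanSpace.single (Sum.inl i) 1 : Total m k) = 0 :=
    fun i => by ext j; simp [uPart]
  have hur : ∀ q, uPart (EuclideanSpace.single (Sum.inr q) 1 : Total m k)
      = EuclideanSpace.single q 1 := fun q => by
    ext j; simp [uPart]
  rw [one_sub_connMatrix, Matrix.fromBlocks_transpose, Matrix.fromBlocks_multiply]
  ext (i | p) (j | q)
  · simp [metricMatrix, metric, hxl, hul, Matrix.mul_apply, connBlock, PiLp.inner_apply,
      Matrix.one_apply, mul_comm, eq_comm]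
  · simp [metricMatrix, metric, hxl, hul, hxr, hur, shift_zero, connBlock, EuclideanSpace.inner_single_right]
  · simp [metricMatrix, metric, hxl, hul, hxr, hur, shift_zero, connBlock, EuclideanSpace.inner_single_left]
  · simp [metricMatrix, metric, hxr, hur, shift_zero, Matrix.one_apply,
      EuclideanSpace.inner_single_left]

theorem connMatrix_mul_self (z : Total m k) : connMatrix b φ z * connMatrix b φ z = 0 := by
  simp [connMatrix, Matrix.fromBlocks_multiply]

/-- Since `N² = 0`, the inverse of `1 - N` is `1 + N`. The inverse metric is thus polynomial in `N`,
hence in `s⁻¹` after rescaling. -/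
theorem metricMatrix_inv (z : Total m k) :
    (metricMatrix b φ z)⁻¹ = (1 + connMatrix b φ z) * (1 + connMatrix b φ z).transpose := by
  set N := connMatrix b φ z with hN
  have hNN : N * N = 0 := connMatrix_mul_self b φ z
  have h1 : (1 - N) * (1 + N) = 1 := by
    rw [sub_mul, mul_add, mul_add, hNN]
    simp
  refine Matrix.inv_eq_right_inv ?_
  rw [metricMatrix_eq, Matrix.mul_assoc, ← Matrix.mul_assoc (1 - N), h1, Matrix.one_mul,
    ← Matrix.transpose_mul, ← Matrix.transpose_one]
  congr 1
  rw [add_mul, mul_sub, mul_sub, ← hN, hNN]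
  simp

theorem metricMatrix_det (z : Total m k) : (metricMatrix b φ z).det = 1 := by
  have h : (1 - connMatrix b φ z).det = 1 := by
    rw [one_sub_connMatrix]
    simp
  rw [metricMatrix_eq, Matrix.det_mul, Matrix.det_transpose, h, one_mul]

/-- The function `φ_s` sees `u` only through `‖s u‖²`, while the rotation field is linear in `u =
s⁻¹ (s u)`. -/
theorem connMatrix_rescale {s : ℝ} (hs : s ≠ 0) (z : Total m k)
    (i j : Fin m ⊕ Fin k × Fin 2) :
    connMatrix b (rescale φ s) z i j = s⁻¹ * connMatrix b φ (scaleVert s z) i j := by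
  have hx : xPart (scaleVert s z) = xPart z := by ext i; simp [xPart]
  have hu : uPart (scaleVert s z) = s • uPart z := by ext i; simp [uPart]
  have hr : radial (rescale φ s) z = radial φ (scaleVert s z) := by
    simp [radial, rescale, hx, hu, norm_smul, mul_pow]
  rcases i with i | ⟨p, l⟩ <;> rcases j with j | q
  · simp [connMatrix]
  · simp [connMatrix]
  · simp only [connMatrix, Matrix.fromBlocks_apply₂₁, connBlock_apply, hr, hx]
    fin_cases l <;> simp <;> field_simp
  · simp [connMatrix]

/-! ### Smoothness, support, divergence and nonvanishing of the connection. -/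

section Regularity

variable {φ}

theorem contDiff_xPart : ContDiff ℝ ∞ (xPart : Total m k → _) := by
  rw [contDiff_euclidean]
  intro i
  change ContDiff ℝ ∞ fun z : Total m k => z (Sum.inl i)
  fun_prop

theorem contDiff_uPart : ContDiff ℝ ∞ (uPart : Total m k → _) := by
  rw [contDiff_euclidean]
  intro q
  change ContDiff ℝ ∞ fun z : Total m k => z (Sum.inr q)
  fun_prop

theorem contDiff_radial (hφ : ContDiffOn ℝ ∞ φ (Ici 0 ×ˢ Ici 0)) :
    ContDiff ℝ ∞ (radial φ : Total m k → ℝ) := by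
  have h : ContDiff ℝ ∞ fun z : Total m k => (‖xPart z‖ ^ 2, ‖uPart z‖ ^ 2) :=
    (contDiff_xPart.norm_sq ℝ).prodMk (contDiff_uPart.norm_sq ℝ)
  exact hφ.comp_contDiff h fun z => ⟨sq_nonneg ‖xPart z‖, sq_nonneg ‖uPart z‖⟩

theorem norm_sq_eq_add (z : Total m k) : ‖z‖ ^ 2 = ‖xPart z‖ ^ 2 + ‖uPart z‖ ^ 2 := by
  simp [EuclideanSpace.norm_sq_eq, Fintype.sum_sum_type, xPart, uPart]

theorem hasCompactSupport_radial (hφ : ∃ K : Set (ℝ × ℝ), IsCompact K ∧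
      ∀ t ∈ Ici (0 : ℝ) ×ˢ Ici (0 : ℝ), t ∉ K → φ t = 0) :
    HasCompactSupport (radial φ : Total m k → ℝ) := by
  obtain ⟨K, hK, h0⟩ := hφ
  obtain ⟨R, hR⟩ := hK.isBounded.subset_closedBall 0
  -- If `(‖x‖², ‖u‖²)` lies in `K`, then `‖z‖² ≤ 2|R|`, which forces `‖z‖ ≤ 1 + 2|R|`.
  refine HasCompactSupport.intro (isCompact_closedBall 0 (1 + 2 * |R|)) fun z hz => ?_
  refine h0 _ ⟨sq_nonneg ‖xPart z‖, sq_nonneg ‖uPart z‖⟩ fun hmem => hz ?_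
  have h1 := mem_closedBall_zero_iff.1 (hR hmem)
  have hx := (Real.le_norm_self _).trans ((norm_fst_le _).trans h1)
  have hu := (Real.le_norm_self _).trans ((norm_snd_le _).trans h1)
  rw [mem_closedBall_zero_iff]
  have h2 := norm_sq_eq_add z
  have h3 := le_abs_self R
  simp only at hx hu
  nlinarith [abs_nonneg R, norm_nonneg z]

theorem contDiff_connBlock_factor (p : Fin k) (l : Fin 2) (i : Fin m) :
    ContDiff ℝ ∞ fun z : Total m k => b (xPart z) (EuclideanSpace.single i 1) p
      * ![-z (Sum.inr (p, 1)), z (Sum.inr (p, 0))] l := by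
  refine ContDiff.mul ?_ ?_
  · have h1 : ContDiff ℝ ∞ fun x : EuclideanSpace ℝ (Fin m) =>
        b.flip (EuclideanSpace.single i 1) x :=
      (LinearMap.toContinuousLinearMap (b.flip (EuclideanSpace.single i 1))).contDiff
    exact (contDiff_euclidean.1 (h1.comp contDiff_xPart)) p
  · fin_cases l
    · change ContDiff ℝ ∞ fun z : Total m k => -z (Sum.inr (p, 1))
      fun_prop
    · change ContDiff ℝ ∞ fun z : Total m k => z (Sum.inr (p, 0))
      fun_prop

theorem isTest_connMatrix (hφ : ContDiffOn ℝ ∞ φ (Ici 0 ×ˢ Ici 0))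
    (hφ' : ∃ K : Set (ℝ × ℝ), IsCompact K ∧
      ∀ t ∈ Ici (0 : ℝ) ×ˢ Ici (0 : ℝ), t ∉ K → φ t = 0)
    (i j : Fin m ⊕ Fin k × Fin 2) : IsTest fun z => connMatrix b φ z i j := by
  rcases i with i | ⟨p, l⟩ <;> rcases j with j | q
  · exact IsTest.zero
  · exact IsTest.zero
  · simp only [connMatrix, Matrix.fromBlocks_apply₂₁, connBlock_apply]
    exact ⟨(contDiff_radial hφ).mul (contDiff_connBlock_factor b p l j),
      (hasCompactSupport_radial hφ').mul_right⟩
  · exact IsTest.zero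

/-- `ψ` is invariant under the rotations of each plane. -/
theorem fderiv_radial_rotation (hφ : ContDiffOn ℝ ∞ φ (Ici 0 ×ˢ Ici 0)) (z : Total m k)
    (p : Fin k) :
    z (Sum.inr (p, 0)) * fderiv ℝ (radial φ) z (EuclideanSpace.single (Sum.inr (p, 1)) 1)
      = z (Sum.inr (p, 1)) * fderiv ℝ (radial φ) z (EuclideanSpace.single (Sum.inr (p, 0)) 1) := by
  set e₀ : Total m k := EuclideanSpace.single (Sum.inr (p, 0)) 1 with he₀
  set e₁ : Total m k := EuclideanSpace.single (Sum.inr (p, 1)) 1 with he₁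
  set a := z (Sum.inr (p, 0)) with ha
  set c := z (Sum.inr (p, 1)) with hc
  -- The orbit of `z` under rotation of the `p`-th plane, written as a displacement from `z`. As `ψ`
  -- is constant along it, its derivative in the direction `γ'(0)` is zero.
  let γ : ℝ → Total m k := fun t => z + ((a * Real.cos t - c * Real.sin t - a) • e₀
    + (a * Real.sin t + c * Real.cos t - c) • e₁)
  have hγ : HasDerivAt γ (-c • e₀ + a • e₁) 0 := by
    have hcos := Real.hasDerivAt_cos 0
    have hsin := Real.hasDerivAt_sin 0
    have h0 := (((hcos.const_mul a).sub (hsin.const_mul c)).sub_const a).smul_const e₀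
    have h1 := (((hsin.const_mul a).add (hcos.const_mul c)).sub_const c).smul_const e₁
    refine HasDerivAt.congr_deriv ((h0.add h1).const_add z) ?_
    simp
  have hγ0 : γ 0 = z := by simp [γ]
  have hx : ∀ t, xPart (γ t) = xPart z := by
    intro t; ext i; simp [γ, xPart, he₀, he₁]
  have hu : ∀ t, ‖uPart (γ t)‖ ^ 2 = ‖uPart z‖ ^ 2 := by
    intro t
    simp only [EuclideanSpace.norm_sq_eq, Fintype.sum_prod_type, Fin.sum_univ_two,
      Real.norm_eq_abs, sq_abs]
    refine Finset.sum_congr rfl fun p' _ => ?_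
    by_cases hp : p' = p
    · subst hp
      simp only [γ, uPart, he₀, he₁, PiLp.add_apply, PiLp.smul_apply, smul_eq_mul,
        PiLp.single_apply]
      simp [← ha, ← hc]
      nlinarith [Real.sin_sq_add_cos_sq t]
    · simp [γ, uPart, he₀, he₁, hp]
  have hconst : (fun t => radial φ (γ t)) = fun _ => radial φ z := by
    ext t; simp [radial, hx, hu]
  have hd : HasFDerivAt (radial φ) (fderiv ℝ (radial φ) z) (γ 0) := by
    rw [hγ0]
    exact ((contDiff_radial hφ).differentiable (by simp) z).hasFDerivAt
  have h1 := hd.comp_hasDerivAt 0 hγ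
  rw [show (radial φ ∘ γ) = fun _ => radial φ z from hconst] at h1
  have h2 := h1.unique (hasDerivAt_const 0 _)
  simp only [map_add, map_smul, smul_eq_mul] at h2
  linarith

/-- A nonzero column is `ψ` times a rotation field. In each plane the divergence is the derivative
of `ψ` along the rotation, which vanishes, plus `ψ` times the divergence of the rotation field,
which also vanishes. -/
theorem sum_vertDeriv_connMatrix (hφ : ContDiffOn ℝ ∞ φ (Ici 0 ×ˢ Ici 0))
    (i : Fin m ⊕ Fin k × Fin 2) (z : Total m k) :
    ∑ j, vertDeriv j (fun z => connMatrix b φ z j i) z = 0 := by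
  rcases i with i | q
  swap
  · have : ∀ j, (fun z => connMatrix b φ z j (Sum.inr q)) = fun _ => 0 := by
      rintro (j | j) <;> simp [connMatrix]
    simp [this, vertDeriv]
  have h0 : ∀ j : Fin m, vertDeriv (Sum.inl j)
      (fun z => connMatrix b φ z (Sum.inl j) (Sum.inl i)) z = 0 := fun j => by
    simp [vertDeriv, vertDir]
  rw [Fintype.sum_sum_type, Finset.sum_eq_zero fun j _ => h0 j, zero_add, Fintype.sum_prod_type]
  refine Finset.sum_eq_zero fun p _ => ?_
  have hψ : DifferentiableAt ℝ (radial φ) z := (contDiff_radial hφ).differentiable (by simp) z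
  have hg : ∀ l, DifferentiableAt ℝ (fun z : Total m k => b (xPart z) (EuclideanSpace.single i 1) p
      * ![-z (Sum.inr (p, 1)), z (Sum.inr (p, 0))] l) z := fun l =>
    (contDiff_connBlock_factor b p l i).differentiable (by simp) z
  -- Each component of a rotation field is independent of its own coordinate.
  have hg0 : ∀ l, fderiv ℝ (fun z : Total m k => b (xPart z) (EuclideanSpace.single i 1) p
      * ![-z (Sum.inr (p, 1)), z (Sum.inr (p, 0))] l) z
      (EuclideanSpace.single (Sum.inr (p, l)) 1) = 0 := by
    intro l
    rw [← (hg l).lineDeriv_eq_fderiv, lineDeriv]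
    have hx : ∀ (q : Fin k × Fin 2) (t : ℝ),
        xPart (z + t • (EuclideanSpace.single (Sum.inr q) 1 : Total m k)) = xPart z := by
      intro q t; ext j; simp [xPart]
    fin_cases l <;> simp [hx]
  have hderiv : ∀ l, vertDeriv (Sum.inr (p, l))
      (fun z => connMatrix b φ z (Sum.inr (p, l)) (Sum.inl i)) z
      = (b (xPart z) (EuclideanSpace.single i 1) p
        * ![-z (Sum.inr (p, 1)), z (Sum.inr (p, 0))] l)
        * fderiv ℝ (radial φ) z (EuclideanSpace.single (Sum.inr (p, l)) 1) := by
    intro l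
    simp only [connMatrix, Matrix.fromBlocks_apply₂₁, connBlock_apply, vertDeriv, vertDir,
      Sum.elim_inr]
    rw [fderiv_fun_mul hψ (hg l)]
    simp only [add_apply, smul_apply, hg0, smul_eq_mul]
    ring
  have hrot := fderiv_radial_rotation hφ z p
  rw [Fin.sum_univ_two, hderiv, hderiv]
  simp only [Matrix.cons_val_zero, Matrix.cons_val_one]
  linear_combination b (xPart z) (EuclideanSpace.single i 1) p * hrot

theorem exists_connMatrix_ne_zero (hb : b ≠ 0) (hφ : ContinuousOn φ (Ici 0 ×ˢ Ici 0))
    (hφ_ne : ∃ t ∈ Ici (0 : ℝ) ×ˢ Ici (0 : ℝ), φ t ≠ 0) :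
    ∃ (z : Total m k) (p : Fin k) (i : Fin m),
      connMatrix b φ z (Sum.inr (p, 1)) (Sum.inl i) ≠ 0 := by
  obtain ⟨x₀, i, p, hp⟩ : ∃ x₀ i p, b x₀ (EuclideanSpace.single i 1) p ≠ 0 := by
    by_contra! h
    refine hb (LinearMap.ext fun x => (EuclideanSpace.basisFun (Fin m) ℝ).toBasis.ext fun i => ?_)
    ext p
    simpa using h x i p
  -- The connection vanishes where `x = 0` or `u = 0`, so a point with `φ ≠ 0` is pushed by
  -- continuity off the boundary of the quadrant.
  obtain ⟨t₁, h₁, t₂, h₂, ht⟩ : ∃ t₁ > 0, ∃ t₂ > 0, φ (t₁, t₂) ≠ 0 := by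
    obtain ⟨t, ht, hne⟩ := hφ_ne
    have hc : ContinuousWithinAt (fun ε : ℝ => φ (t.1 + ε, t.2 + ε)) (Ici 0) 0 := by
      refine ContinuousWithinAt.comp (t := Ici (0 : ℝ) ×ˢ Ici (0 : ℝ)) ?_
        (f := fun ε : ℝ => (t.1 + ε, t.2 + ε)) (by fun_prop) ?_
      · simpa using hφ t ht
      · exact fun ε hε => mem_prod.2 ⟨add_nonneg (mem_Ici.1 ht.1) hε, add_nonneg (mem_Ici.1 ht.2) hε⟩
    have hev := (hc.mono Ioi_subset_Ici_self).eventually_ne (b₂ := 0) (by simpa using hne)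
    obtain ⟨ε, hε, hpos⟩ := (hev.and self_mem_nhdsWithin).exists
    exact ⟨t.1 + ε, add_pos_of_nonneg_of_pos ht.1 hpos, t.2 + ε,
      add_pos_of_nonneg_of_pos ht.2 hpos, hε⟩
  have hx₀ : ‖x₀‖ ≠ 0 := by
    intro h
    rw [norm_eq_zero.1 h] at hp
    simp at hp
  -- Scaled so that `‖x‖² = t₁` and `‖u‖² = t₂`; with `u` on the first axis of plane `p`, the
  -- rotation field has a nonzero `(p, 1)` component.
  set x := (√t₁ / ‖x₀‖) • x₀ with hx
  set u : Planes k := √t₂ • EuclideanSpace.single (p, 0) 1 with hu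
  refine ⟨pair x u, p, i, ?_⟩
  have hxP : xPart (pair x u) = x := rfl
  have huP : uPart (pair x u) = u := rfl
  have hxn : ‖x‖ ^ 2 = t₁ := by
    rw [hx, norm_smul, Real.norm_of_nonneg (by positivity), div_mul_cancel₀ _ hx₀,
      Real.sq_sqrt h₁.le]
  have hun : ‖u‖ ^ 2 = t₂ := by
    rw [hu, norm_smul, Real.norm_of_nonneg (by positivity)]
    simp [Real.sq_sqrt h₂.le]
  have hu0 : pair x u (Sum.inr (p, 0)) = √t₂ := by simp [pair, hu]
  rw [connMatrix, Matrix.fromBlocks_apply₂₁, connBlock_apply, radial, hxP, huP, hxn, hun]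
  refine mul_ne_zero ht (mul_ne_zero ?_ ?_)
  · rw [hx, map_smul, LinearMap.smul_apply, PiLp.smul_apply, smul_eq_mul]
    exact mul_ne_zero (div_ne_zero (Real.sqrt_pos.2 h₁).ne' hx₀) hp
  · simpa [hu0] using (Real.sqrt_pos.2 h₂).ne'

end Regularity

end Connection

/-! ### Finiteness of the zeros of the integral. -/

section Zeros

variable {α β : Type*} [Fintype α] [Fintype β]

theorem exists_integral_comp_scaleVert {s : ℝ} (hs : s ≠ 0) :
    ∃ r : ℝ, r ≠ 0 ∧ ∀ f : EuclideanSpace ℝ (α ⊕ β) → ℝ, Continuous f →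
      ∫ z, f (scaleVert s z) = r * ∫ z, f z := by
  set L : EuclideanSpace ℝ (α ⊕ β) →ₗ[ℝ] EuclideanSpace ℝ (α ⊕ β) := (scaleVert s).toLinearMap
  have hdet : LinearMap.det L ≠ 0 := by
    have h : L ∘ₗ (scaleVert s⁻¹).toLinearMap = LinearMap.id :=
      LinearMap.ext fun z => scaleVert_scaleVert_inv hs z
    have h' := congrArg LinearMap.det h
    rw [LinearMap.det_comp, LinearMap.det_id] at h'
    exact left_ne_zero_of_mul_eq_one h'
  refine ⟨|(LinearMap.det L)⁻¹|, abs_ne_zero.2 (inv_ne_zero hdet), fun f hf => ?_⟩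
  have h := integral_map (μ := volume) (φ := L) (scaleVert s).continuous.aemeasurable
    hf.aestronglyMeasurable
  rw [Measure.map_linearMap_addHaar_eq_smul_addHaar _ hdet, integral_smul_measure,
    ENNReal.toReal_ofReal (abs_nonneg _), smul_eq_mul] at h
  exact h.symm

theorem HasLeadingTerm.finite_integral_eq_zero {e : ℤ}
    {Q : ℝ → EuclideanSpace ℝ (α ⊕ β) → ℝ} {Q₀ : EuclideanSpace ℝ (α ⊕ β) → ℝ}
    (h : HasLeadingTerm e Q Q₀) {K : Set (EuclideanSpace ℝ (α ⊕ β))} (hK : IsCompact K)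
    (hQK : ∀ s, 0 < s → ∀ z, scaleVert s z ∉ K → Q s z = 0) (h0 : ∫ z, Q₀ z ≠ 0) :
    {s : ℝ | 0 < s ∧ ∫ z, Q s z = 0}.Finite := by
  obtain ⟨F, hF, rfl, hs⟩ := h
  obtain ⟨N, c, hc, hsum⟩ := exists_sum_of_mem_polyFamilies hF
  have coeff_poly : ∀ (a : ℕ → ℝ) (n : ℕ), n ∈ Finset.range (N + 1) →
      (∑ n ∈ Finset.range (N + 1), Polynomial.monomial n (a n)).coeff n = a n := by
    intro a n hn
    simp only [Polynomial.finsetSum_coeff, Polynomial.coeff_monomial]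
    rw [Finset.sum_ite_eq' _ n, if_pos hn]
  have eval_poly : ∀ (a : ℕ → ℝ) (t : ℝ),
      (∑ n ∈ Finset.range (N + 1), Polynomial.monomial n (a n)).eval t
        = ∑ n ∈ Finset.range (N + 1), t ^ n * a n := by
    intro a t
    simp [Polynomial.eval_finsetSum, mul_comm]
  -- Outside `K`, the polynomial `t ↦ F t y` vanishes for all `t > 0`, so all its coefficients
  -- vanish. This makes every coefficient function integrable.
  have hcK : ∀ y, y ∉ K → ∀ n ∈ Finset.range (N + 1), c n y = 0 := by
    intro y hy n hn
    have hroot : ∀ t : ℝ, 0 < t → F t y = 0 := by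
      intro t ht
      have h1 := hs t⁻¹ (inv_pos.2 ht) (scaleVert t⁻¹⁻¹ y)
      rw [scaleVert_scaleVert_inv (inv_ne_zero ht.ne'), inv_inv, hQK _ (inv_pos.2 ht)] at h1
      · exact (mul_eq_zero.1 h1.symm).resolve_left (zpow_ne_zero _ (inv_ne_zero ht.ne'))
      · have h2 := scaleVert_scaleVert_inv (inv_ne_zero ht.ne') y
        rw [inv_inv] at h2
        rwa [h2]
    have hp := Polynomial.eq_zero_of_infinite_isRoot
      (∑ n ∈ Finset.range (N + 1), Polynomial.monomial n (c n y))
      ((Ioi_infinite (0 : ℝ)).mono fun t ht => by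
        change Polynomial.eval t _ = 0
        rw [eval_poly, ← hsum]
        exact hroot t ht)
    rw [← coeff_poly (fun n => c n y) n hn, hp, Polynomial.coeff_zero]
  have hint : ∀ n ∈ Finset.range (N + 1), Integrable (c n) := fun n hn =>
    (hc n).continuous.integrable_of_hasCompactSupport
      (HasCompactSupport.intro hK fun y hy => hcK y hy n hn)
  -- Integrating coefficientwise gives a polynomial whose value at `0` is `∫ Q₀`. Up to nonzero
  -- factors, `P(s⁻¹)` is the integral of `Q s`.
  set P := ∑ n ∈ Finset.range (N + 1), Polynomial.monomial n (∫ y, c n y) with hP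
  have hPeval : ∀ t, P.eval t = ∫ y, F t y := by
    intro t
    rw [hP, eval_poly]
    simp only [hsum]
    rw [integral_finsetSum _ fun n hn => (hint n hn).const_mul _]
    simp only [integral_const_mul]
  have hP0 : P ≠ 0 := by
    intro hzero
    have := hPeval 0
    rw [hzero, Polynomial.eval_zero] at this
    exact h0 this.symm
  have hroots : {t : ℝ | P.IsRoot t}.Finite := Polynomial.finite_setOfPred_isRoot hP0
  refine (hroots.preimage inv_injective.injOn).subset fun s ⟨hpos, hzero⟩ => ?_
  obtain ⟨r, hr, hcomp⟩ := exists_integral_comp_scaleVert (α := α) (β := β) hpos.ne'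
  simp only [hs s hpos] at hzero
  rw [integral_const_mul, hcomp _ (contDiff_of_mem_polyFamilies hF _).continuous,
    ← hPeval] at hzero
  exact (mul_eq_zero.1 ((mul_eq_zero.1 hzero).resolve_left (zpow_ne_zero _ hpos.ne'))).resolve_left
    hr

end Zeros

/-! ### Assembly for the rescaled metrics. -/

section Main

variable {m k : ℕ}
  {b : EuclideanSpace ℝ (Fin m) →ₗ[ℝ] EuclideanSpace ℝ (Fin m) →ₗ[ℝ] EuclideanSpace ℝ (Fin k)}
  {φ : ℝ × ℝ → ℝ} (hφ : ContDiffOn ℝ ∞ φ (Ici 0 ×ˢ Ici 0))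
  (hφ' : ∃ K : Set (ℝ × ℝ), IsCompact K ∧ ∀ t ∈ Ici (0 : ℝ) ×ˢ Ici (0 : ℝ), t ∉ K → φ t = 0)

include hφ hφ'

theorem hasLeadingTerm_connMatrix (i j : Fin m ⊕ Fin k × Fin 2) :
    HasLeadingTerm (-1) (fun s z => connMatrix b (rescale φ s) z i j)
      fun z => connMatrix b φ z i j :=
  ⟨_, const_mem_polyFamilies (isTest_connMatrix b hφ hφ' i j).1, rfl, fun s hs z => by
    rw [zpow_neg_one]; exact connMatrix_rescale b φ hs.ne' z i j⟩

/-- In the expansion of `(1 - N)ᵀ (1 - N)`, the product `Nᵀ N` has order `-2`, so only the linear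
terms reach the leading coefficient. -/
theorem hasLeadingTerm_metricMatrix (i j : Fin m ⊕ Fin k × Fin 2) :
    HasLeadingTerm (-1) (fun s z => metricMatrix b (rescale φ s) z i j
        - (1 : Matrix (Fin m ⊕ Fin k × Fin 2) (Fin m ⊕ Fin k × Fin 2) ℝ) i j)
      fun z => -(connMatrix b φ z i j + connMatrix b φ z j i) := by
  have hN := hasLeadingTerm_connMatrix (b := b) hφ hφ'
  refine ((((hN i j).add (hN j i)).neg).add (HasLeadingTerm.sum Finset.univ fun l =>
    (hN l i).mul (hN l j)).raise).congr (by norm_num) (fun s _ z => ?_) fun z => (add_zero _).symm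
  rw [metricMatrix_eq, Matrix.transpose_sub, Matrix.transpose_one, sub_mul, mul_sub, mul_sub,
    one_mul, mul_one, one_mul]
  simp only [Matrix.sub_apply, Matrix.transpose_apply, Matrix.mul_apply]
  ring

theorem hasLeadingTerm_metricMatrix_inv (i j : Fin m ⊕ Fin k × Fin 2) :
    HasLeadingTerm 0 (fun s z => (metricMatrix b (rescale φ s) z)⁻¹ i j)
      fun _ => (1 : Matrix (Fin m ⊕ Fin k × Fin 2) (Fin m ⊕ Fin k × Fin 2) ℝ) i j := by
  have hN := hasLeadingTerm_connMatrix (b := b) hφ hφ'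
  refine ((((hN i j).add (hN j i)).add (HasLeadingTerm.sum Finset.univ fun l =>
    (hN i l).mul (hN j l)).raise).raise.add (HasLeadingTerm.const
    ((1 : Matrix (Fin m ⊕ Fin k × Fin 2) (Fin m ⊕ Fin k × Fin 2) ℝ) i j))).congr (by norm_num)
    (fun s _ z => ?_) fun z => (zero_add _).symm
  rw [metricMatrix_inv, Matrix.transpose_add, Matrix.transpose_one, add_mul, mul_add, mul_add,
    one_mul, mul_one, one_mul]
  simp only [Matrix.add_apply, Matrix.transpose_apply, Matrix.mul_apply]
  ring

theorem finite_a2_eq_zero (hb : b ≠ 0)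
    (hφ_ne : ∃ t ∈ Ici (0 : ℝ) ×ˢ Ici (0 : ℝ), φ t ≠ 0) :
    {s : ℝ | 0 < s ∧ a2 (metricMatrix b (rescale φ s)) = 0}.Finite := by
  set h : Fin m ⊕ Fin k × Fin 2 → Fin m ⊕ Fin k × Fin 2 → Total m k → ℝ :=
    fun i j z => -(connMatrix b φ z i j + connMatrix b φ z j i) with hdef
  have hN := isTest_connMatrix b hφ hφ'
  have hdiv : ∀ i z, ∑ j, vertDeriv j (h i j) z = 0 := by
    intro i z
    have h1 : ∀ j, vertDeriv j (fun z => connMatrix b φ z i j) z = 0 := by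
      rintro (j | q)
      · simp [vertDeriv, vertDir]
      · have : (fun z => connMatrix b φ z i (Sum.inr q)) = fun _ => 0 := by
          rcases i with i | i <;> simp [connMatrix]
        simp [this, vertDeriv]
    have h2 : ∀ j, vertDeriv j (h i j) z = -vertDeriv j (fun z => connMatrix b φ z j i) z := by
      intro j
      have h3 := ((hN i j).differentiable z).hasFDerivAt.add ((hN j i).differentiable z).hasFDerivAt
      have h4 := congrArg (fun L => L (vertDir j)) h3.neg.fderiv
      have h5 := h1 j
      simp only [vertDeriv] at h5 ⊢
      refine h4.trans ?_
      simp [h5]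
    simp only [h2, Finset.sum_neg_distrib, sum_vertDeriv_connMatrix b hφ i z, neg_zero]
  have htr : ∀ z, ∑ j, h j j z = 0 := by
    intro z
    refine Finset.sum_eq_zero fun j _ => ?_
    rcases j with j | j <;> simp [hdef, connMatrix]
  obtain ⟨z₀, p, i, hz₀⟩ := exists_connMatrix_ne_zero b hb hφ.continuousOn hφ_ne
  have hne : ∫ z, linIntegrand h z ≠ 0 :=
    integral_linIntegrand_ne_zero (fun i j => ((hN i j).add (hN j i)).neg)
      (fun i j => by ext z; simp [hdef, add_comm]) hdiv htr (p, 0)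
      (i := Sum.inr (p, 1)) (j := Sum.inl i) (z := z₀) (by simpa [hdef, connMatrix] using hz₀)
  set K : Set (Total m k) := ⋃ q : (Fin m ⊕ Fin k × Fin 2) × (Fin m ⊕ Fin k × Fin 2),
    tsupport fun z => connMatrix b φ z q.1 q.2 with hKdef
  have hK : IsCompact K := isCompact_iUnion fun q => (hN q.1 q.2).2.isCompact
  have hfin := (hasLeadingTerm_integrand (hasLeadingTerm_metricMatrix (b := b) hφ hφ')
    (hasLeadingTerm_metricMatrix_inv (b := b) hφ hφ')
    fun s _ z => metricMatrix_det b _ z).finite_integral_eq_zero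
    hK (fun s hs z hz => ?_) hne
  · refine hfin.subset fun s ⟨hs, h0⟩ => ⟨hs, ?_⟩
    refine (mul_eq_zero.1 h0).resolve_left (div_ne_zero (Real.rpow_pos_of_pos ?_ _).ne' ?_)
    · positivity
    · norm_num
  -- Off `K` in the scaled variable, the connection vanishes on a neighbourhood and the metric is
  -- Euclidean there.
  · have hopen : IsOpen Kᶜ := hK.isClosed.isOpen_compl
    refine integrand_eq_zero_of_eventuallyEq (M := 1) ?_
    filter_upwards [(hopen.preimage (scaleVert s).continuous).mem_nhds hz] with y hy
    have hy0 : connMatrix b (rescale φ s) y = 0 := by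
      ext i j
      rw [connMatrix_rescale b φ hs.ne']
      have : connMatrix b φ (scaleVert s y) i j = 0 :=
        image_eq_zero_of_notMem_tsupport (f := fun z => connMatrix b φ z i j)
          fun hmem => hy (mem_iUnion.2 ⟨(i, j), hmem⟩)
      simp [this]
    rw [metricMatrix_eq, hy0]
    simp

end Main

end HeatInvariant

theorem theorem5p1 (m k : ℕ) (hk : k = 2 ∨ k = 3)
    (b : EuclideanSpace ℝ (Fin m) →ₗ[ℝ] EuclideanSpace ℝ (Fin m) →ₗ[ℝ]
      EuclideanSpace ℝ (Fin k))
    (hb : b ≠ 0)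
    (φ : ℝ × ℝ → ℝ)
    (hφ_smooth : ContDiffOn ℝ ∞ φ (Ici 0 ×ˢ Ici 0))
    (hφ_nonneg : ∀ t ∈ Ici (0 : ℝ) ×ˢ Ici (0 : ℝ), 0 ≤ φ t)
    (hφ_supp : ∃ K : Set (ℝ × ℝ), IsCompact K ∧
      ∀ t ∈ Ici (0 : ℝ) ×ˢ Ici (0 : ℝ), t ∉ K → φ t = 0)
    (hφ_ne : ∃ t ∈ Ici (0 : ℝ) ×ˢ Ici (0 : ℝ), φ t ≠ 0) :
    {s : ℝ | 0 < s ∧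
      HeatInvariant.a2 (HeatInvariant.metricMatrix b (HeatInvariant.rescale φ s)) = 0}.Finite := by
  exact HeatInvariant.finite_a2_eq_zero hφ_smooth hφ_supp hb hφ_ne
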